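/- **Setting.** Let $\Omega=(l_1,l_2)\times(l_3,l_4)$, let $\psi:\mathbb R^2\to\mathbb R$ be smooth, $\Gamma=\{p\in\Omega:\psi(p)=0\}$, $\Omega^{\pm}=\{p\in\Omega:\pm\psi(p)>0\}$. Let $a>0$ and $f$ be smooth and $u$ be $C^5$ on $\Omega\setminus\Gamma$, with $-\nabla\cdot(a\nabla u)=f$ in $\Omega\setminus\Gamma$. For a point $p=(x,y)$ and a mesh size $h>0$ the nodes of the compact stencil are $(x+kh,y+\ell h)$, $k,\ell\in\{-1,0,1\}$; $p$ is a *regular point* (for $h$) if $\psi\ge 0$ at all nine nodes or $\psi<0$ at all nine nodes. Write $w^{(m,n)}=\partial_x^m\partial_y^n w(p)$ and $\Lambda_K=\{(m,n)\in\mathbb N_0^2: m+n\le K\}$. **The formula.** Put, with $C_{k,\ell}(h)=\widetilde C_{k,\ell}(h)/\big(24\,(a^{(0,0)})^3\big)$, $$\big((u_h)_x\big)(p)=\frac1h\sum_{k,\ell=-1}^{1} C_{k,\ell}(h)\,u(x+kh,y+\ell h)-\frac1h\sum_{(m,n)\in\Lambda_2} f^{(m,n)}\,C_{f,m,n}(h),$$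 where, abbreviating $a_{mn}=a^{(m,n)}$, - $\widetilde C_{-1,-1}=\big[-11(a_{12}+a_{21}+a_{03}+a_{30})a_{00}^2+\big((22a_{02}+35a_{20}+11a_{11})a_{01}+(11a_{02}+46a_{20}+11a_{11})a_{10}\big)a_{00}-11a_{01}^3+a_{01}^2a_{10}-47a_{01}a_{10}^2-59a_{10}^3\big]h^3+\big[(22a_{02}-24a_{20}+46a_{11})a_{00}+a_{01}^2-71a_{01}a_{10}+48a_{10}^2\big]a_{00}h^2+2(a_{01}-11a_{10})a_{00}^2h+20a_{00}^3$, - $\widetilde C_{-1,0}=\big[11(a_{03}+a_{21})a_{00}^2-\big((22a_{02}+35a_{20})a_{01}+11a_{10}a_{11}\big)a_{00}+11a_{01}^3-12a_{01}^2a_{10}+59a_{01}a_{10}^2\big]h^3-\big[(44a_{02}-44a_{20}+48a_{11})a_{00}+2a_{01}^2-96a_{01}a_{10}+22a_{10}^2\big]a_{00}h^2-88a_{00}^2a_{10}h+80a_{00}^3$, - $\widetilde C_{-1,1}=a_{00}\big(\big[(22a_{02}-24a_{20}+2a_{11})a_{00}+(a_{01}-a_{10})(a_{01}-48a_{10})\big]h^2+22(a_{01}-a_{10})a_{00}h+20a_{00}^2\big)$,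 - $\widetilde C_{0,-1}=\big[11(a_{30}+a_{12})a_{00}^2-\big((11a_{02}+46a_{20})a_{10}+11a_{01}a_{11}\big)a_{00}+11a_{01}^2a_{10}-12a_{01}a_{10}^2+59a_{10}^3\big]h^3-\big[48a_{00}a_{11}+24a_{01}(a_{01}-4a_{10})\big]a_{00}h^2-(44a_{01}+48a_{10})a_{00}^2h+88a_{00}^3$, - $\widetilde C_{0,0}=4a_{00}\big(\big[(a_{20}+12a_{11})a_{00}+6a_{01}^2-18a_{01}a_{10}-\tfrac{37}{2}a_{10}^2\big]h^2-(12a_{01}-57a_{10})a_{00}h-110a_{00}^2\big)$, - $\widetilde C_{0,1}=a_{00}^2\big(88a_{00}+(44a_{01}-48a_{10})h\big)$, - $\widetilde C_{1,-1}=24a_{00}^3,\quad \widetilde C_{1,0}=96a_{00}^3,\quad \widetilde C_{1,1}=24a_{00}^2(a_{01}h+a_{00})$, and $C_{f,m,n}(h)=\sum_{k,\ell=-1}^1 C_{k,\ell}(h)\,H_{m,n}(kh,\ell h)$. Here $H_{m,n}(s,t)$ is the coefficient of $f^{(m,n)}$ in the Taylor polynomial $\sum_{(m',n')\in\Lambda_4}\frac{u^{(m',n')}}{m'!\,n'!}s^{m'}t^{n'}$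 after every $u^{(m',n')}$ with $m'\ge2$ has been expressed, by repeated use of the differentiated equation $\partial_x^{m'-2}\partial_y^{n'}(a u_{xx}+au_{yy}+a_xu_x+a_yu_y)=-f^{(m'-2,n')}$ at $p$, through the free quantities $u^{(0,n)}$, $u^{(1,n)}$ and the derivatives of $a$ and $f$ at $p$. The approximation $(u_h)_y$ of $u_y$ is the same formula with the two variables exchanged (in the stencil and in all derivatives of $a$ and $f$). **Theorem.** 1. (Fourth order.) For every compact $S\subset\Omega\setminus\Gamma$ there are $K,h_0>0$ such that for all $p\in S$ and $0<h\le h_0$ the point $p$ is regular and $$|(u_h)_x(p)-u_x(p)|\le Kh^4,\qquad |(u_h)_y(p)-u_y(p)|\le Kh^4 .$$ 2. (Uniformly over all regular points.) Suppose $\nabla\psi\neq0$ on $\Gamma$, let $s\in\{+,-\}$, and suppose that the restrictions of $a,f,u$ to $\Omega^s$ extend to functions $A,F\in C^\infty(\mathbb R^2)$, $U\in C^5(\mathbb R^2)$ with $A>0$ on $\overline{\Omega^s}$. Then there is $K>0$ such that the two bounds in 1, with $A,F,U$ in place of $a,f,u$, hold for all $h>0$ and all $p$ whose nine nodes lie in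 $\overline\Omega=[l_1,l_2]\times[l_3,l_4]$ and on side $s$ (that is, $\psi\ge0$ at all of them if $s=+$, $\psi<0$ if $s=-$). 3. (Maximal order.) Let $p\in\Omega\setminus\Gamma$ and $\theta\in\mathbb R$. For $M\in\mathbb N_0$ consider polynomials $C_{k,\ell}(h)$, $C_{f,m,n}(h)$ in $h$, not depending on $u$ and $f$, such that for all $u\in C^\infty(\mathbb R^2)$ and all $f$ with $-\nabla\cdot(a\nabla u)=f$ in $\Omega\setminus\Gamma$, as $h\to0^+$, $$h\,(u_x,u_y)(p)\cdot(\cos\theta,\sin\theta)=\sum_{k,\ell=-1}^1C_{k,\ell}(h)\,u(x+kh,y+\ell h)-\sum_{m+n\le M-1}f^{(m,n)}C_{f,m,n}(h)+\mathcal O(h^{M+2}),$$ i.e. a compact approximation of the directional derivative of accuracy order $M+1$. Such polynomials exist for $M=3$, with degrees at most $4$, and polynomials of whatever degrees exist for no $M\ge4$. So the maximal order of accuracy $M+1$ of a compact gradient approximation at a regular point is four. -/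

import Mathlib

open Set Filter Topology Asymptotics
open scoped ContDiff

noncomputable section

/-! ### Partial derivatives and the elliptic operator -/

/-- The partial derivative `∂w/∂x`. -/
def partialX (w : ℝ × ℝ → ℝ) (p : ℝ × ℝ) : ℝ := deriv (fun s : ℝ => w (s, p.2)) p.1

/-- The partial derivative `∂w/∂y`. -/
def partialY (w : ℝ × ℝ → ℝ) (p : ℝ × ℝ) : ℝ := deriv (fun t : ℝ => w (p.1, t)) p.2

/-- The derivatives `w^(m,n) = ∂^(m+n) w / ∂x^m ∂y^n` at the point `p`. -/
def jet (w : ℝ × ℝ → ℝ) (p : ℝ × ℝ) (m n : ℕ) : ℝ := (partialX^[m] (partialY^[n] w)) p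

/-- The equation `-∇ · (a ∇u) = f` on the set `D`. -/
def SolvesOn (a u f : ℝ × ℝ → ℝ) (D : Set (ℝ × ℝ)) : Prop :=
  ∀ p ∈ D, -(partialX (fun q => a q * partialX u q) p
    + partialY (fun q => a q * partialY u q) p) = f p

/-! ### The domain, the interface and regular points -/

/-- The open rectangle `(l₁, l₂) × (l₃, l₄)`. -/
def rect (l₁ l₂ l₃ l₄ : ℝ) : Set (ℝ × ℝ) := Ioo l₁ l₂ ×ˢ Ioo l₃ l₄

/-- `Ω \ Γ`, where `Γ` is the zero set of `ψ` in `Ω`. -/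
def offInterface (Ω : Set (ℝ × ℝ)) (ψ : ℝ × ℝ → ℝ) : Set (ℝ × ℝ) := {p ∈ Ω | ψ p ≠ 0}

/-- The two sides of the interface. -/
inductive Side where
  | plus
  | minus

/-- The subregions `Ω⁺` and `Ω⁻`. -/
def Side.region (s : Side) (Ω : Set (ℝ × ℝ)) (ψ : ℝ × ℝ → ℝ) : Set (ℝ × ℝ) :=
  match s with
  | .plus => {p ∈ Ω | 0 < ψ p}
  | .minus => {p ∈ Ω | ψ p < 0}

/-- The points counted as lying on the given side; those with `ψ = 0` belong to the plus side. -/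
def Side.points (s : Side) (ψ : ℝ × ℝ → ℝ) : Set (ℝ × ℝ) :=
  match s with
  | .plus => {p | 0 ≤ ψ p}
  | .minus => {p | ψ p < 0}

/-- The indices `-1, 0, 1` of the compact stencil. -/
def stencil : Finset ℤ := Finset.Icc (-1) 1

/-- The grid node `(x + k h, y + ℓ h)` around the centre `p = (x, y)`. -/
def node (p : ℝ × ℝ) (h : ℝ) (k l : ℤ) : ℝ × ℝ := (p.1 + k * h, p.2 + l * h)

/-- The centre `p` of a mesh of size `h` is regular: all nine nodes lie on one side. -/
def IsRegularPoint (ψ : ℝ × ℝ → ℝ) (p : ℝ × ℝ) (h : ℝ) : Prop :=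
  ∃ s : Side, ∀ k ∈ stencil, ∀ l ∈ stencil, node p h k l ∈ s.points ψ

/-! ### Elimination of the higher `x`-derivatives by the equation -/

/-- The index set `Λ_K` of all `(m, n)` with `m + n ≤ K`. -/
def Lam (K : ℕ) : Finset (ℕ × ℕ) :=
  (Finset.range (K + 1) ×ˢ Finset.range (K + 1)).filter (fun q => q.1 + q.2 ≤ K)

/-- `reduce α φ υ m n` is the value of `u^(m,n)` that the derivatives of
`-∇ · (a ∇u) = f` at a point force, when `a^(i,j) = α i j` and `f^(i,j) = φ i j` there, and
the free quantities are `u^(0,n) = υ 0 n`, `u^(1,n) = υ 1 n`. The clause for `m + 2` is the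
equation `∂x^m ∂y^n (a u_xx + a u_yy + a_x u_x + a_y u_y) = -f^(m,n)`, expanded by the
Leibniz rule and solved for `u^(m+2,n)`. -/
def reduce (α φ υ : ℕ → ℕ → ℝ) : ℕ → ℕ → ℝ
  | 0, n => υ 0 n
  | 1, n => υ 1 n
  | m + 2, n =>
    -reduce α φ υ m (n + 2)
      - (φ m n + ∑ i : Fin (m + 1), ∑ j : Fin (n + 1),
          (m.choose i : ℝ) * (n.choose j : ℝ) *
            ((if _h : (i : ℕ) + (j : ℕ) = 0 then 0
              else α i j * (reduce α φ υ (m - i + 2) (n - j) + reduce α φ υ (m - i) (n - j + 2)))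
            + α (i + 1) j * reduce α φ υ (m - i + 1) (n - j)
            + α i (j + 1) * reduce α φ υ (m - i) (n - j + 1))) / α 0 0
termination_by m n => (m + n, m)
decreasing_by
  all_goals
    simp only [Prod.lex_def]
    omega

/-- The polynomial `H_{m,n}(x, y)`: the total coefficient of `f^(m,n)` in the Taylor polynomial
of `u` of total degree `K`, after all `u^(m',n')` with `m' ≥ 2` have been eliminated. -/
def polyH (α : ℕ → ℕ → ℝ) (K m n : ℕ) (x y : ℝ) : ℝ :=
  ∑ q ∈ Lam K,
    reduce α (fun i j => if (i, j) = (m, n) then 1 else 0) (fun _ _ => 0) q.1 q.2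
      / ((q.1.factorial : ℝ) * (q.2.factorial : ℝ)) * x ^ q.1 * y ^ q.2

/-! ### The explicit compact formula for the gradient -/

/-- The stencil coefficients for `u_x`, up to the common factor `24 (a^(0,0))^3`. -/
def rawCoeff (α : ℕ → ℕ → ℝ) (h : ℝ) (k l : ℤ) : ℝ :=
  match k, l with
  | -1, -1 =>
      ((-11 * α 1 2 - 11 * α 2 1 - 11 * α 0 3 - 11 * α 3 0) * α 0 0 ^ 2 + ((22 * α 0 2 +
      35 * α 2 0 + 11 * α 1 1) * α 0 1 + (11 * (α 0 2 + (46/11) * α 2 0 + α 1 1)) * α 1 0) * α 0 0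
      - 11 * α 0 1 ^ 3 + α 0 1 ^ 2 * α 1 0 - 47 * α 0 1 * α 1 0 ^ 2 - 59 * α 1 0 ^ 3) * h ^ 3 +
      (22 * ((α 0 2 - (12/11) * α 2 0 + (23/11) * α 1 1) * α 0 0 + (1/22) * α 0 1 ^ 2 -
      (71/22) * α 0 1 * α 1 0 + (24/11) * α 1 0 ^ 2)) * α 0 0 * h ^ 2 + 2 * h * (α 0 1 -
      11 * α 1 0) * α 0 0 ^ 2 + 20 * α 0 0 ^ 3
  | -1, 0 =>
      ((11 * α 0 3 + 11 * α 2 1) * α 0 0 ^ 2 + ((-22 * α 0 2 - 35 * α 2 0) * α 0 1 -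
      11 * α 1 0 * α 1 1) * α 0 0 + 11 * α 0 1 ^ 3 - 12 * α 0 1 ^ 2 * α 1 0 +
      59 * α 0 1 * α 1 0 ^ 2) * h ^ 3 - 44 * α 0 0 * ((α 0 2 - α 2 0 + (12/11) * α 1 1) * α 0 0 +
      (1/22) * α 0 1 ^ 2 - (24/11) * α 0 1 * α 1 0 + (1/2) * α 1 0 ^ 2) * h ^ 2 -
      88 * h * α 0 0 ^ 2 * α 1 0 + 80 * α 0 0 ^ 3
  | -1, 1 =>
      22 * α 0 0 * (((α 0 2 - (12/11) * α 2 0 + (1/11) * α 1 1) * α 0 0 + (1 / 22 * (α 0 1 -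
      α 1 0)) * (α 0 1 - 48 * α 1 0)) * h ^ 2 + h * (α 0 1 - α 1 0) * α 0 0 + (10/11) * α 0 0 ^ 2)
  | 0, -1 =>
      ((11 * α 3 0 + 11 * α 1 2) * α 0 0 ^ 2 + ((-11 * α 0 2 - 46 * α 2 0) * α 1 0 -
      11 * α 0 1 * α 1 1) * α 0 0 + 11 * α 0 1 ^ 2 * α 1 0 - 12 * α 0 1 * α 1 0 ^ 2 +
      59 * α 1 0 ^ 3) * h ^ 3 - 48 * α 0 0 * (α 0 0 * α 1 1 + (1/2) * α 0 1 * (α 0 1 -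
      4 * α 1 0)) * h ^ 2 - 44 * α 0 0 ^ 2 * (α 0 1 + (12/11) * α 1 0) * h + 88 * α 0 0 ^ 3
  | 0, 0 =>
      4 * α 0 0 * (((α 2 0 + 12 * α 1 1) * α 0 0 + 6 * α 0 1 ^ 2 - 18 * α 0 1 * α 1 0 -
      (37/2) * α 1 0 ^ 2) * h ^ 2 - 12 * α 0 0 * (α 0 1 - (19/4) * α 1 0) * h - 110 * α 0 0 ^ 2)
  | 0, 1 =>
      44 * α 0 0 ^ 2 * (2 * α 0 0 + h * (α 0 1 - (12/11) * α 1 0))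
  | 1, -1 =>
      24 * α 0 0 ^ 3
  | 1, 0 =>
      96 * α 0 0 ^ 3
  | 1, 1 =>
      24 * α 0 0 ^ 2 * (h * α 0 1 + α 0 0)
  | _, _ => 0

/-- The stencil coefficients `C_{k,ℓ}(h)` for `u_x`. -/
def gradCoeff (α : ℕ → ℕ → ℝ) (h : ℝ) (k l : ℤ) : ℝ := rawCoeff α h k l / (24 * α 0 0 ^ 3)

/-- The coefficients `C_{f,m,n}(h)` of the derivatives of the source term. -/
def gradSourceCoeff (α : ℕ → ℕ → ℝ) (h : ℝ) (m n : ℕ) : ℝ :=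
  ∑ k ∈ stencil, ∑ l ∈ stencil, gradCoeff α h k l * polyH α 4 m n (k * h) (l * h)

/-- The approximation of `u_x` from the derivatives `α` of `a` and `φ` of `f` at the centre and
the nodal values `v`. -/
def gradX (α φ : ℕ → ℕ → ℝ) (v : ℤ → ℤ → ℝ) (h : ℝ) : ℝ :=
  1 / h * (∑ k ∈ stencil, ∑ l ∈ stencil, gradCoeff α h k l * v k l)
    - 1 / h * ∑ q ∈ Lam 2, φ q.1 q.2 * gradSourceCoeff α h q.1 q.2

/-- The approximation of `u_y`, obtained from that of `u_x` by exchanging the two variables. -/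
def gradY (α φ : ℕ → ℕ → ℝ) (v : ℤ → ℤ → ℝ) (h : ℝ) : ℝ :=
  gradX (fun m n => α n m) (fun m n => φ n m) (fun k l => v l k) h

/-! ### General compact approximations of a directional derivative -/

/-- The polynomials `C k l` and `Cf m n` in `h` give, at the point `p`, a compact approximation of
accuracy order `M + 1` for the derivative in the direction `(cos θ, sin θ)` of the solutions of
`-∇ · (a ∇u) = f` on `D`. It uses the derivatives of `f` of order at most `M - 1`. The
coefficients may depend on `a`, `p` and `θ`, but not on `u` and `f`. -/
def IsCompactGradientScheme (a : ℝ × ℝ → ℝ) (D : Set (ℝ × ℝ)) (p : ℝ × ℝ) (θ : ℝ) (M : ℕ)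
    (C : ℤ → ℤ → Polynomial ℝ) (Cf : ℕ → ℕ → Polynomial ℝ) : Prop :=
  ∀ u f : ℝ × ℝ → ℝ, ContDiff ℝ ∞ u → SolvesOn a u f D →
    (fun h : ℝ =>
      h * (Real.cos θ * partialX u p + Real.sin θ * partialY u p)
        - (∑ k ∈ stencil, ∑ l ∈ stencil, (C k l).eval h * u (node p h k l)
          - ∑ q ∈ (Lam M).filter (fun q => q.1 + q.2 < M), jet f p q.1 q.2 * (Cf q.1 q.2).eval h))
      =O[𝓝[>] 0] (fun h : ℝ => h ^ (M + 2))

end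

/-! ### Calculus of partial derivatives on open sets -/

/-! Consistency. Near a point the nodal values of `u` are those of its fourth degree Taylor
polynomial up to `O(h ^ 5)` (`exists_taylor_bound`). The derivatives of `a`, `f`, `u` at that point
satisfy six linear equations, collected in `JetEq`: the equation differentiated at most twice. By
linearity the derivatives of `u` up to order four split into a part solving the homogeneous
equations with the same free quantities and a part linear in the derivatives of `f` (`JetEq.split`).
The source coefficients are the stencil applied to that second part, so they cancel it exactly. For
the homogeneous part the powers `h ^ 0, ..., h ^ 4` of the stencil sum reduce to `h * u_x`; this is
a finite list of polynomial identities (`order_conditions`). What is left is `h ^ 5` times a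
polynomial in `h` whose coefficients depend continuously on the point. Division by `h` gives order
four, uniformly on compact sets (`exists_gradient_bound`), and exchanging the variables gives the
formula for `u_y`.

Up to the interface, the six equations are closed conditions on the point, so they persist on the
closure of a side for the extended data (`JetEq.of_mem_closure`). The condition on the gradient of
`ψ` puts every admissible centre into that closure, which is compact.

Maximality. Let `P` be a harmonic homogeneous polynomial about `p`. Terms of higher degree can be
added to it, one monomial of the residual at a time, until the source has no derivatives of order
less than `M` at `p` (`exists_correction`). Testing a scheme on the resulting solution leaves only
the leading weights `C k l` at `h = 0`: applied to `P` they must give the directional derivative in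
degree one, and zero in degrees two to `M + 1` (`IsCompactGradientScheme.tendsto`). If `M ≥ 4`, this
applies to the harmonics of degrees one, three and five. On nine nodes those odd in `x` span only
two dimensions, and likewise those odd in `y`, so the conditions force `cos θ = sin θ = 0`
(`IsCompactGradientScheme.le_three`). -/

theorem hasDerivAt_sliceX {w : ℝ × ℝ → ℝ} {p : ℝ × ℝ} (hw : DifferentiableAt ℝ w p) :
    HasDerivAt (fun s : ℝ => w (s, p.2)) (fderiv ℝ w p (1, 0)) p.1 := by
  have h : HasDerivAt (fun s : ℝ => (s, p.2)) ((1 : ℝ), (0 : ℝ)) p.1 :=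
    (hasDerivAt_id _).prodMk (hasDerivAt_const _ _)
  exact HasFDerivAt.comp_hasDerivAt (f := fun s : ℝ => (s, p.2)) p.1
    (by simpa using hw.hasFDerivAt) h

theorem hasDerivAt_sliceY {w : ℝ × ℝ → ℝ} {p : ℝ × ℝ} (hw : DifferentiableAt ℝ w p) :
    HasDerivAt (fun t : ℝ => w (p.1, t)) (fderiv ℝ w p (0, 1)) p.2 := by
  have h : HasDerivAt (fun t : ℝ => (p.1, t)) ((0 : ℝ), (1 : ℝ)) p.2 :=
    (hasDerivAt_const _ _).prodMk (hasDerivAt_id _)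
  exact HasFDerivAt.comp_hasDerivAt (f := fun t : ℝ => (p.1, t)) p.2
    (by simpa using hw.hasFDerivAt) h

theorem partialX_eq_fderiv {w : ℝ × ℝ → ℝ} {p : ℝ × ℝ} (hw : DifferentiableAt ℝ w p) :
    partialX w p = fderiv ℝ w p (1, 0) := (hasDerivAt_sliceX hw).deriv

theorem partialY_eq_fderiv {w : ℝ × ℝ → ℝ} {p : ℝ × ℝ} (hw : DifferentiableAt ℝ w p) :
    partialY w p = fderiv ℝ w p (0, 1) := (hasDerivAt_sliceY hw).deriv

theorem partialX_congr {v w : ℝ × ℝ → ℝ} {p : ℝ × ℝ} (h : v =ᶠ[𝓝 p] w) :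
    partialX v p = partialX w p := by
  have hc : Tendsto (fun s : ℝ => (s, p.2)) (𝓝 p.1) (𝓝 p) := by
    have : Continuous (fun s : ℝ => (s, p.2)) := by fun_prop
    simpa using this.tendsto p.1
  exact Filter.EventuallyEq.deriv_eq (hc.eventually h)

theorem partialY_congr {v w : ℝ × ℝ → ℝ} {p : ℝ × ℝ} (h : v =ᶠ[𝓝 p] w) :
    partialY v p = partialY w p := by
  have hc : Tendsto (fun t : ℝ => (p.1, t)) (𝓝 p.2) (𝓝 p) := by
    have : Continuous (fun t : ℝ => (p.1, t)) := by fun_prop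
    simpa using this.tendsto p.2
  exact Filter.EventuallyEq.deriv_eq (hc.eventually h)

theorem Set.EqOn.partialX {v w : ℝ × ℝ → ℝ} {V : Set (ℝ × ℝ)} (hV : IsOpen V) (h : EqOn v w V) :
    EqOn (partialX v) (partialX w) V := fun _ hp =>
  partialX_congr (h.eventuallyEq_of_mem (hV.mem_nhds hp))

theorem Set.EqOn.partialY {v w : ℝ × ℝ → ℝ} {V : Set (ℝ × ℝ)} (hV : IsOpen V) (h : EqOn v w V) :
    EqOn (partialY v) (partialY w) V := fun _ hp =>
  partialY_congr (h.eventuallyEq_of_mem (hV.mem_nhds hp))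

theorem Set.EqOn.iterate_partialX {v w : ℝ × ℝ → ℝ} {V : Set (ℝ × ℝ)} (hV : IsOpen V)
    (h : EqOn v w V) (m : ℕ) : EqOn (_root_.partialX^[m] v) (_root_.partialX^[m] w) V := by
  induction m with
  | zero => exact h
  | succ m ih => simpa only [Function.iterate_succ_apply'] using ih.partialX hV

theorem Set.EqOn.iterate_partialY {v w : ℝ × ℝ → ℝ} {V : Set (ℝ × ℝ)} (hV : IsOpen V)
    (h : EqOn v w V) (m : ℕ) : EqOn (_root_.partialY^[m] v) (_root_.partialY^[m] w) V := by
  induction m with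
  | zero => exact h
  | succ m ih => simpa only [Function.iterate_succ_apply'] using ih.partialY hV

theorem Set.EqOn.jet {v w : ℝ × ℝ → ℝ} {V : Set (ℝ × ℝ)} (hV : IsOpen V) (h : EqOn v w V)
    {p : ℝ × ℝ} (hp : p ∈ V) : jet v p = jet w p := by
  funext m n
  exact (h.iterate_partialY hV n).iterate_partialX hV m hp

theorem ContDiffOn.partialX {w : ℝ × ℝ → ℝ} {V : Set (ℝ × ℝ)} {m n : WithTop ℕ∞}
    (hw : ContDiffOn ℝ n w V) (hV : IsOpen V) (hmn : m + 1 ≤ n) :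
    ContDiffOn ℝ m (partialX w) V := by
  have h1 : ContDiffOn ℝ m (fun p => fderiv ℝ w p (1, 0)) V :=
    (hw.fderiv_of_isOpen hV hmn).clm_apply contDiffOn_const
  refine h1.congr fun p hp => partialX_eq_fderiv ?_
  exact (hw.differentiableOn (by rintro rfl; simp at hmn)).differentiableAt (hV.mem_nhds hp)

theorem ContDiffOn.partialY {w : ℝ × ℝ → ℝ} {V : Set (ℝ × ℝ)} {m n : WithTop ℕ∞}
    (hw : ContDiffOn ℝ n w V) (hV : IsOpen V) (hmn : m + 1 ≤ n) :
    ContDiffOn ℝ m (partialY w) V := by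
  have h1 : ContDiffOn ℝ m (fun p => fderiv ℝ w p (0, 1)) V :=
    (hw.fderiv_of_isOpen hV hmn).clm_apply contDiffOn_const
  refine h1.congr fun p hp => partialY_eq_fderiv ?_
  exact (hw.differentiableOn (by rintro rfl; simp at hmn)).differentiableAt (hV.mem_nhds hp)

theorem partialY_partialX_comm {w : ℝ × ℝ → ℝ} {V : Set (ℝ × ℝ)} (hV : IsOpen V)
    (hw : ContDiffOn ℝ 2 w V) : EqOn (partialY (partialX w)) (partialX (partialY w)) V := by
  intro p hp
  have hd : ∀ q ∈ V, DifferentiableAt ℝ w q := fun q hq =>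
    (hw.differentiableOn (by norm_num)).differentiableAt (hV.mem_nhds hq)
  have h2 : DifferentiableAt ℝ (fderiv ℝ w) p :=
    ((hw.fderiv_of_isOpen hV (m := 1) (by norm_num)).differentiableOn
      (by norm_num)).differentiableAt (hV.mem_nhds hp)
  have key : ∀ v z : ℝ × ℝ, fderiv ℝ (fun q => fderiv ℝ w q v) p z
      = fderiv ℝ (fderiv ℝ w) p z v := by
    intro v z
    rw [fderiv_clm_apply h2 (differentiableAt_const _)]
    simp
  have hX : EqOn (partialX w) (fun q => fderiv ℝ w q (1, 0)) V :=
    fun q hq => partialX_eq_fderiv (hd q hq)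
  have hY : EqOn (partialY w) (fun q => fderiv ℝ w q (0, 1)) V :=
    fun q hq => partialY_eq_fderiv (hd q hq)
  rw [hX.partialY hV hp, hY.partialX hV hp,
    partialY_eq_fderiv (h2.clm_apply (differentiableAt_const _)),
    partialX_eq_fderiv (h2.clm_apply (differentiableAt_const _)), key, key]
  exact ((hw.contDiffAt (hV.mem_nhds hp)).isSymmSndFDerivAt (by simp)).eq _ _

theorem ContDiffOn.iterate_partialX {V : Set (ℝ × ℝ)} (hV : IsOpen V) (k m : ℕ) :
    ∀ {w : ℝ × ℝ → ℝ}, ContDiffOn ℝ (k + m : ℕ) w V → ContDiffOn ℝ k (_root_.partialX^[m] w) V := by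
  induction m with
  | zero => exact fun h => h
  | succ m ih =>
    intro w h
    rw [Function.iterate_succ_apply]
    exact ih (h.partialX hV (by exact_mod_cast le_rfl))

theorem ContDiffOn.iterate_partialY {V : Set (ℝ × ℝ)} (hV : IsOpen V) (k m : ℕ) :
    ∀ {w : ℝ × ℝ → ℝ}, ContDiffOn ℝ (k + m : ℕ) w V → ContDiffOn ℝ k (_root_.partialY^[m] w) V := by
  induction m with
  | zero => exact fun h => h
  | succ m ih =>
    intro w h
    rw [Function.iterate_succ_apply]
    exact ih (h.partialY hV (by exact_mod_cast le_rfl))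

theorem ContDiffOn.jet {V : Set (ℝ × ℝ)} (hV : IsOpen V) {k m n : ℕ} {w : ℝ × ℝ → ℝ}
    (h : ContDiffOn ℝ (k + m + n : ℕ) w V) : ContDiffOn ℝ k (fun p => jet w p m n) V :=
  ContDiffOn.iterate_partialX hV k m (ContDiffOn.iterate_partialY hV (k + m) n h)

/-- `jet` applies the `y`-derivatives first, so raising its second index from outside means moving
one `∂y` past all the `∂x`. -/
theorem partialY_iterate_partialX {V : Set (ℝ × ℝ)} (hV : IsOpen V) (m : ℕ) :
    ∀ {w : ℝ × ℝ → ℝ}, ContDiffOn ℝ (m + 1 : ℕ) w V →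
      EqOn (partialY (partialX^[m] w)) (partialX^[m] (partialY w)) V := by
  induction m with
  | zero => exact fun _ => eqOn_refl _ _
  | succ m ih =>
    intro w h
    rw [Function.iterate_succ_apply, Function.iterate_succ_apply]
    refine (ih (h.partialX hV (by exact_mod_cast le_rfl))).trans ?_
    refine (partialY_partialX_comm hV (h.of_le ?_)).iterate_partialX hV m
    have : 2 ≤ m + 1 + 1 := by omega
    exact_mod_cast this

theorem iterate_partialY_partialX {V : Set (ℝ × ℝ)} (hV : IsOpen V) (n : ℕ) :
    ∀ {w : ℝ × ℝ → ℝ}, ContDiffOn ℝ (n + 1 : ℕ) w V →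
      EqOn (partialY^[n] (partialX w)) (partialX (partialY^[n] w)) V := by
  induction n with
  | zero => exact fun _ => eqOn_refl _ _
  | succ n ih =>
    intro w h
    rw [Function.iterate_succ_apply, Function.iterate_succ_apply]
    refine EqOn.trans ?_ (ih (h.partialY hV (by exact_mod_cast le_rfl)))
    refine (partialY_partialX_comm hV (h.of_le ?_)).iterate_partialY hV n
    have : 2 ≤ n + 1 + 1 := by omega
    exact_mod_cast this

theorem partialX_jet (w : ℝ × ℝ → ℝ) (p : ℝ × ℝ) (m n : ℕ) :
    partialX (fun q => jet w q m n) p = jet w p (m + 1) n := by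
  simp only [jet, Function.iterate_succ_apply']

theorem partialY_jet {V : Set (ℝ × ℝ)} (hV : IsOpen V) {m n : ℕ} {w : ℝ × ℝ → ℝ}
    (h : ContDiffOn ℝ (m + 1 + n : ℕ) w V) {p : ℝ × ℝ} (hp : p ∈ V) :
    partialY (fun q => jet w q m n) p = jet w p m (n + 1) := by
  have := partialY_iterate_partialX hV m (ContDiffOn.iterate_partialY hV (m + 1) n h) hp
  simpa only [jet, Function.iterate_succ_apply'] using this

theorem jet_partialX {V : Set (ℝ × ℝ)} (hV : IsOpen V) {n : ℕ} {w : ℝ × ℝ → ℝ}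
    (h : ContDiffOn ℝ (n + 1 : ℕ) w V) {p : ℝ × ℝ} (hp : p ∈ V) (m : ℕ) :
    jet (partialX w) p m n = jet w p (m + 1) n := by
  have := ((iterate_partialY_partialX hV n h).iterate_partialX hV m) hp
  simpa only [jet, Function.iterate_succ_apply] using this

theorem jet_partialY (w : ℝ × ℝ → ℝ) (p : ℝ × ℝ) (m n : ℕ) :
    jet (partialY w) p m n = jet w p m (n + 1) := by
  simp only [jet, Function.iterate_succ_apply]

theorem partialX_add {v w : ℝ × ℝ → ℝ} {p : ℝ × ℝ} (hv : DifferentiableAt ℝ v p)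
    (hw : DifferentiableAt ℝ w p) :
    partialX (fun q => v q + w q) p = partialX v p + partialX w p :=
  deriv_fun_add (hasDerivAt_sliceX hv).differentiableAt (hasDerivAt_sliceX hw).differentiableAt

theorem partialY_add {v w : ℝ × ℝ → ℝ} {p : ℝ × ℝ} (hv : DifferentiableAt ℝ v p)
    (hw : DifferentiableAt ℝ w p) :
    partialY (fun q => v q + w q) p = partialY v p + partialY w p :=
  deriv_fun_add (hasDerivAt_sliceY hv).differentiableAt (hasDerivAt_sliceY hw).differentiableAt

theorem partialX_mul {v w : ℝ × ℝ → ℝ} {p : ℝ × ℝ} (hv : DifferentiableAt ℝ v p)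
    (hw : DifferentiableAt ℝ w p) :
    partialX (fun q => v q * w q) p = partialX v p * w p + v p * partialX w p :=
  deriv_fun_mul (hasDerivAt_sliceX hv).differentiableAt (hasDerivAt_sliceX hw).differentiableAt

theorem partialY_mul {v w : ℝ × ℝ → ℝ} {p : ℝ × ℝ} (hv : DifferentiableAt ℝ v p)
    (hw : DifferentiableAt ℝ w p) :
    partialY (fun q => v q * w q) p = partialY v p * w p + v p * partialY w p :=
  deriv_fun_mul (hasDerivAt_sliceY hv).differentiableAt (hasDerivAt_sliceY hw).differentiableAt

/-! ### The differentiated equation -/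

/-- The equations `∂x^m ∂y^n (a u_xx + a u_yy + a_x u_x + a_y u_y) = -f^(m,n)`, `m + n ≤ 2`, at a
point where `a`, `f`, `u` have the derivatives `α`, `φ`, `υ`. -/
structure JetEq (α φ υ : ℕ → ℕ → ℝ) : Prop where
  e00 : α 0 0 * (υ 2 0 + υ 0 2) + α 1 0 * υ 1 0 + α 0 1 * υ 0 1 + φ 0 0 = 0
  e10 : α 1 0 * (υ 2 0 + υ 0 2) + α 0 0 * (υ 3 0 + υ 1 2) + α 2 0 * υ 1 0 + α 1 0 * υ 2 0
    + α 1 1 * υ 0 1 + α 0 1 * υ 1 1 + φ 1 0 = 0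
  e01 : α 0 1 * (υ 2 0 + υ 0 2) + α 0 0 * (υ 2 1 + υ 0 3) + α 1 1 * υ 1 0 + α 1 0 * υ 1 1
    + α 0 2 * υ 0 1 + α 0 1 * υ 0 2 + φ 0 1 = 0
  e20 : α 2 0 * (υ 2 0 + υ 0 2) + 2 * α 1 0 * (υ 3 0 + υ 1 2) + α 0 0 * (υ 4 0 + υ 2 2)
    + α 3 0 * υ 1 0 + 2 * α 2 0 * υ 2 0 + α 1 0 * υ 3 0
    + α 2 1 * υ 0 1 + 2 * α 1 1 * υ 1 1 + α 0 1 * υ 2 1 + φ 2 0 = 0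
  e11 : α 1 1 * (υ 2 0 + υ 0 2) + α 1 0 * (υ 2 1 + υ 0 3) + α 0 1 * (υ 3 0 + υ 1 2)
    + α 0 0 * (υ 3 1 + υ 1 3) + α 2 1 * υ 1 0 + α 2 0 * υ 1 1 + α 1 1 * υ 2 0 + α 1 0 * υ 2 1
    + α 1 2 * υ 0 1 + α 1 1 * υ 0 2 + α 0 2 * υ 1 1 + α 0 1 * υ 1 2 + φ 1 1 = 0
  e02 : α 0 2 * (υ 2 0 + υ 0 2) + 2 * α 0 1 * (υ 2 1 + υ 0 3) + α 0 0 * (υ 2 2 + υ 0 4)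
    + α 1 2 * υ 1 0 + 2 * α 1 1 * υ 1 1 + α 1 0 * υ 1 2
    + α 0 3 * υ 0 1 + 2 * α 0 2 * υ 0 2 + α 0 1 * υ 0 3 + φ 0 2 = 0

/-- The operator is symmetric in the two variables; this is what reduces every statement about
`gradY` to one about `gradX`. -/
theorem JetEq.swap {α φ υ : ℕ → ℕ → ℝ} (h : JetEq α φ υ) :
    JetEq (fun m n => α n m) (fun m n => φ n m) (fun m n => υ n m) where
  e00 := by linear_combination h.e00
  e10 := by linear_combination h.e01
  e01 := by linear_combination h.e10
  e20 := by linear_combination h.e02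
  e11 := by linear_combination h.e11
  e02 := by linear_combination h.e20

theorem hasDerivAt_jet_x {V : Set (ℝ × ℝ)} (hV : IsOpen V) {w : ℝ × ℝ → ℝ} {m n : ℕ}
    (h : ContDiffOn ℝ (1 + m + n : ℕ) w V) {p : ℝ × ℝ} (hp : p ∈ V) :
    HasDerivAt (fun s : ℝ => jet w (s, p.2) m n) (jet w p (m + 1) n) p.1 := by
  have hd : DifferentiableAt ℝ (fun q => jet w q m n) p :=
    ((ContDiffOn.jet hV h).differentiableOn (by norm_num)).differentiableAt (hV.mem_nhds hp)
  have := hasDerivAt_sliceX hd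
  rwa [← partialX_eq_fderiv hd, partialX_jet] at this

theorem hasDerivAt_jet_y {V : Set (ℝ × ℝ)} (hV : IsOpen V) {w : ℝ × ℝ → ℝ} {m n : ℕ}
    (h : ContDiffOn ℝ (1 + m + n : ℕ) w V) {p : ℝ × ℝ} (hp : p ∈ V) :
    HasDerivAt (fun t : ℝ => jet w (p.1, t) m n) (jet w p m (n + 1)) p.2 := by
  have hd : DifferentiableAt ℝ (fun q => jet w q m n) p :=
    ((ContDiffOn.jet hV h).differentiableOn (by norm_num)).differentiableAt (hV.mem_nhds hp)
  have := hasDerivAt_sliceY hd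
  rwa [← partialY_eq_fderiv hd, partialY_jet hV (by rwa [add_comm m 1]) hp] at this

/-- The equation expresses `f` on the open set `V` through derivatives of `a` and `u`, so that
identity may itself be differentiated. Since `u` is of class `C^5`, all its derivatives of order at
most four are still differentiable. -/
theorem SolvesOn.jetEq {V : Set (ℝ × ℝ)} (hV : IsOpen V) {a f u : ℝ × ℝ → ℝ}
    (ha : ContDiffOn ℝ 5 a V) (hu : ContDiffOn ℝ 5 u V) (h : SolvesOn a u f V) {p : ℝ × ℝ}
    (hp : p ∈ V) : JetEq (jet a p) (jet f p) (jet u p) := by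
  have hc : ∀ {w : ℝ × ℝ → ℝ}, ContDiffOn ℝ 5 w V → ∀ m n : ℕ, m + n ≤ 4 →
      ContDiffOn ℝ (1 + m + n : ℕ) w V := fun hw m n hmn => hw.of_le (by
    have : 1 + m + n ≤ 5 := by omega
    exact_mod_cast this)
  have ax : ∀ q ∈ V, ∀ m n : ℕ, m + n ≤ 4 →
      HasDerivAt (fun s : ℝ => jet a (s, q.2) m n) (jet a q (m + 1) n) q.1 :=
    fun q hq m n hmn => hasDerivAt_jet_x hV (hc ha m n hmn) hq
  have ay : ∀ q ∈ V, ∀ m n : ℕ, m + n ≤ 4 →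
      HasDerivAt (fun t : ℝ => jet a (q.1, t) m n) (jet a q m (n + 1)) q.2 :=
    fun q hq m n hmn => hasDerivAt_jet_y hV (hc ha m n hmn) hq
  have ux : ∀ q ∈ V, ∀ m n : ℕ, m + n ≤ 4 →
      HasDerivAt (fun s : ℝ => jet u (s, q.2) m n) (jet u q (m + 1) n) q.1 :=
    fun q hq m n hmn => hasDerivAt_jet_x hV (hc hu m n hmn) hq
  have uy : ∀ q ∈ V, ∀ m n : ℕ, m + n ≤ 4 →
      HasDerivAt (fun t : ℝ => jet u (q.1, t) m n) (jet u q m (n + 1)) q.2 :=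
    fun q hq m n hmn => hasDerivAt_jet_y hV (hc hu m n hmn) hq
  have f00 : EqOn (fun q => jet f q 0 0) (fun q => -(jet a q 0 0 * (jet u q 2 0 + jet u q 0 2)
      + jet a q 1 0 * jet u q 1 0 + jet a q 0 1 * jet u q 0 1)) V := by
    intro q hq
    have h1 := ((ax q hq 0 0 (by norm_num)).mul (ux q hq 1 0 (by norm_num))).deriv
    have h2 := ((ay q hq 0 0 (by norm_num)).mul (uy q hq 0 1 (by norm_num))).deriv
    have h3 := h q hq
    simp only [partialX, partialY] at h3
    simp only [jet, Function.iterate_zero, Function.iterate_succ, Function.comp, id, Pi.mul_def,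
      partialX, partialY] at h1 h2 h3 ⊢
    rw [← h3, h1, h2]
    ring
  have f10 : EqOn (fun q => jet f q 1 0) (fun q => -(jet a q 1 0 * (jet u q 2 0 + jet u q 0 2)
      + jet a q 0 0 * (jet u q 3 0 + jet u q 1 2) + jet a q 2 0 * jet u q 1 0
      + jet a q 1 0 * jet u q 2 0 + jet a q 1 1 * jet u q 0 1 + jet a q 0 1 * jet u q 1 1)) V := by
    intro q hq
    refine ((partialX_jet f q 0 0).symm.trans (f00.partialX hV hq)).trans ?_
    refine ((((ax q hq 0 0 (by norm_num)).mul ((ux q hq 2 0 (by norm_num)).add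
      (ux q hq 0 2 (by norm_num)))).add ((ax q hq 1 0 (by norm_num)).mul
      (ux q hq 1 0 (by norm_num)))).add ((ax q hq 0 1 (by norm_num)).mul
      (ux q hq 0 1 (by norm_num)))).neg.deriv.trans ?_
    simp only [Pi.add_apply]
    ring
  have f01 : EqOn (fun q => jet f q 0 1) (fun q => -(jet a q 0 1 * (jet u q 2 0 + jet u q 0 2)
      + jet a q 0 0 * (jet u q 2 1 + jet u q 0 3) + jet a q 1 1 * jet u q 1 0
      + jet a q 1 0 * jet u q 1 1 + jet a q 0 2 * jet u q 0 1 + jet a q 0 1 * jet u q 0 2)) V := by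
    intro q hq
    refine (f00.partialY hV hq).trans ?_
    refine ((((ay q hq 0 0 (by norm_num)).mul ((uy q hq 2 0 (by norm_num)).add
      (uy q hq 0 2 (by norm_num)))).add ((ay q hq 1 0 (by norm_num)).mul
      (uy q hq 1 0 (by norm_num)))).add ((ay q hq 0 1 (by norm_num)).mul
      (uy q hq 0 1 (by norm_num)))).neg.deriv.trans ?_
    simp only [Pi.add_apply]
    ring
  refine ⟨?_, ?_, ?_, ?_, ?_, ?_⟩
  · linear_combination f00 hp
  · linear_combination f10 hp
  · linear_combination f01 hp
  · have := ((partialX_jet f p 1 0).symm.trans (f10.partialX hV hp)).trans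
      ((((((((ax p hp 1 0 (by norm_num)).mul ((ux p hp 2 0 (by norm_num)).add
        (ux p hp 0 2 (by norm_num)))).add ((ax p hp 0 0 (by norm_num)).mul
        ((ux p hp 3 0 (by norm_num)).add (ux p hp 1 2 (by norm_num))))).add
        ((ax p hp 2 0 (by norm_num)).mul (ux p hp 1 0 (by norm_num)))).add
        ((ax p hp 1 0 (by norm_num)).mul (ux p hp 2 0 (by norm_num)))).add
        ((ax p hp 1 1 (by norm_num)).mul (ux p hp 0 1 (by norm_num)))).add
        ((ax p hp 0 1 (by norm_num)).mul (ux p hp 1 1 (by norm_num)))).neg.deriv)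
    simp only [Pi.add_apply] at this
    linear_combination this
  -- The mixed derivative of `f` is taken as `∂x` of `∂y f`, the order built into `jet`, so
  -- derivatives of `f` need not be commuted.
  · have := ((partialX_jet f p 0 1).symm.trans (f01.partialX hV hp)).trans
      ((((((((ax p hp 0 1 (by norm_num)).mul ((ux p hp 2 0 (by norm_num)).add
        (ux p hp 0 2 (by norm_num)))).add ((ax p hp 0 0 (by norm_num)).mul
        ((ux p hp 2 1 (by norm_num)).add (ux p hp 0 3 (by norm_num))))).add
        ((ax p hp 1 1 (by norm_num)).mul (ux p hp 1 0 (by norm_num)))).add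
        ((ax p hp 1 0 (by norm_num)).mul (ux p hp 1 1 (by norm_num)))).add
        ((ax p hp 0 2 (by norm_num)).mul (ux p hp 0 1 (by norm_num)))).add
        ((ax p hp 0 1 (by norm_num)).mul (ux p hp 0 2 (by norm_num)))).neg.deriv)
    simp only [Pi.add_apply] at this
    linear_combination this
  · have := (f01.partialY hV hp).trans
      ((((((((ay p hp 0 1 (by norm_num)).mul ((uy p hp 2 0 (by norm_num)).add
        (uy p hp 0 2 (by norm_num)))).add ((ay p hp 0 0 (by norm_num)).mul
        ((uy p hp 2 1 (by norm_num)).add (uy p hp 0 3 (by norm_num))))).add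
        ((ay p hp 1 1 (by norm_num)).mul (uy p hp 1 0 (by norm_num)))).add
        ((ay p hp 1 0 (by norm_num)).mul (uy p hp 1 1 (by norm_num)))).add
        ((ay p hp 0 2 (by norm_num)).mul (uy p hp 0 1 (by norm_num)))).add
        ((ay p hp 0 1 (by norm_num)).mul (uy p hp 0 2 (by norm_num)))).neg.deriv)
    simp only [Pi.add_apply] at this
    have h2 : partialY (fun q => jet f q 0 1) p = jet f p 0 2 := rfl
    rw [h2] at this
    linear_combination this

/-! ### Algebra of the elimination -/

theorem JetEq.sub {α φ υ φ' υ' : ℕ → ℕ → ℝ} (h : JetEq α φ υ) (h' : JetEq α φ' υ') :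
    JetEq α (fun m n => φ m n - φ' m n) (fun m n => υ m n - υ' m n) where
  e00 := by linear_combination h.e00 - h'.e00
  e10 := by linear_combination h.e10 - h'.e10
  e01 := by linear_combination h.e01 - h'.e01
  e20 := by linear_combination h.e20 - h'.e20
  e11 := by linear_combination h.e11 - h'.e11
  e02 := by linear_combination h.e02 - h'.e02

theorem JetEq.add_mul {α φ υ φ' υ' : ℕ → ℕ → ℝ} (h : JetEq α φ υ) (c : ℝ)
    (h' : JetEq α φ' υ') :
    JetEq α (fun m n => φ m n + c * φ' m n) (fun m n => υ m n + c * υ' m n) where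
  e00 := by linear_combination h.e00 + c * h'.e00
  e10 := by linear_combination h.e10 + c * h'.e10
  e01 := by linear_combination h.e01 + c * h'.e01
  e20 := by linear_combination h.e20 + c * h'.e20
  e11 := by linear_combination h.e11 + c * h'.e11
  e02 := by linear_combination h.e02 + c * h'.e02

theorem JetEq.sum {ι : Type*} {α : ℕ → ℕ → ℝ} (s : Finset ι) (c : ι → ℝ)
    {φ υ : ι → ℕ → ℕ → ℝ} (h : ∀ i ∈ s, JetEq α (φ i) (υ i)) :
    JetEq α (fun m n => ∑ i ∈ s, c i * φ i m n) (fun m n => ∑ i ∈ s, c i * υ i m n) := by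
  classical
  induction s using Finset.induction_on with
  | empty => constructor <;> simp
  | insert i s hi ih =>
    have := (ih fun j hj => h j (Finset.mem_insert_of_mem hj)).add_mul (c i)
      (h i (Finset.mem_insert_self i s))
    simpa only [Finset.sum_insert hi, add_comm] using this

theorem mem_Lam {K : ℕ} {q : ℕ × ℕ} : q ∈ Lam K ↔ q.1 + q.2 ≤ K := by
  simp only [Lam, Finset.mem_filter, Finset.mem_product, Finset.mem_range]
  omega

/-- Only derivatives of the source of order at most two enter the six equations, which is why the
formula sums over `Lam 2`. -/
theorem JetEq.congr_source {α φ φ' υ : ℕ → ℕ → ℝ} (h : JetEq α φ υ)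
    (hφ : ∀ q ∈ Lam 2, φ q.1 q.2 = φ' q.1 q.2) : JetEq α φ' υ := by
  have hφ' : ∀ m n, m + n ≤ 2 → φ m n = φ' m n := fun m n hmn => hφ (m, n) (mem_Lam.2 hmn)
  constructor
  · rw [← hφ' 0 0 (by norm_num)]; exact h.e00
  · rw [← hφ' 1 0 (by norm_num)]; exact h.e10
  · rw [← hφ' 0 1 (by norm_num)]; exact h.e01
  · rw [← hφ' 2 0 (by norm_num)]; exact h.e20
  · rw [← hφ' 1 1 (by norm_num)]; exact h.e11
  · rw [← hφ' 0 2 (by norm_num)]; exact h.e02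

theorem reduce_zero (α φ υ : ℕ → ℕ → ℝ) (n : ℕ) : reduce α φ υ 0 n = υ 0 n := by rw [reduce]

theorem reduce_one (α φ υ : ℕ → ℕ → ℝ) (n : ℕ) : reduce α φ υ 1 n = υ 1 n := by rw [reduce]

/-- Multiplied by `α 0 0`, the recursive clause is the Leibniz expansion of the differentiated
equation; the pair `i = j = 0` is left out of the double sum because it carries the derivative
solved for. -/
theorem jetEq_reduce {α : ℕ → ℕ → ℝ} (hα : α 0 0 ≠ 0) (φ υ : ℕ → ℕ → ℝ) :
    JetEq α φ (reduce α φ υ) := by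
  have key : ∀ m n : ℕ, α 0 0 * (reduce α φ υ (m + 2) n + reduce α φ υ m (n + 2))
      + (φ m n + ∑ i : Fin (m + 1), ∑ j : Fin (n + 1), (m.choose i : ℝ) * (n.choose j : ℝ) *
            ((if _h : (i : ℕ) + (j : ℕ) = 0 then 0
              else α i j * (reduce α φ υ (m - i + 2) (n - j) + reduce α φ υ (m - i) (n - j + 2)))
            + α (i + 1) j * reduce α φ υ (m - i + 1) (n - j)
            + α i (j + 1) * reduce α φ υ (m - i) (n - j + 1))) = 0 := by
    intro m n
    rw [reduce]
    field_simp
    ring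
  constructor
  · have := key 0 0
    simp only [Fin.sum_univ_succ, Fin.sum_univ_zero] at this
    norm_num at this
    linear_combination this
  · have := key 1 0
    simp only [Fin.sum_univ_succ, Fin.sum_univ_zero] at this
    norm_num at this
    linear_combination this
  · have := key 0 1
    simp only [Fin.sum_univ_succ, Fin.sum_univ_zero] at this
    norm_num at this
    linear_combination this
  · have := key 2 0
    simp only [Fin.sum_univ_succ, Fin.sum_univ_zero] at this
    norm_num at this
    linear_combination this
  · have := key 1 1
    simp only [Fin.sum_univ_succ, Fin.sum_univ_zero] at this
    norm_num at this
    linear_combination this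
  · have := key 0 2
    simp only [Fin.sum_univ_succ, Fin.sum_univ_zero] at this
    norm_num at this
    linear_combination this

/-- The homogeneous equations determine all derivatives of order at most four from those of order
at most one in `x`. -/
theorem JetEq.eq_zero {α υ : ℕ → ℕ → ℝ} (hα : α 0 0 ≠ 0) (h : JetEq α (fun _ _ => 0) υ)
    (h0 : ∀ n, υ 0 n = 0) (h1 : ∀ n, υ 1 n = 0) : ∀ q ∈ Lam 4, υ q.1 q.2 = 0 := by
  obtain ⟨e00, e10, e01, e20, e11, e02⟩ := h
  simp only [h0, h1, add_zero, mul_zero] at e00 e10 e01 e20 e11 e02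
  have h20 : υ 2 0 = 0 := by simpa [hα] using e00
  have h30 : υ 3 0 = 0 := by simpa [hα, h20] using e10
  have h21 : υ 2 1 = 0 := by simpa [hα, h20] using e01
  have h22 : υ 2 2 = 0 := by simpa [hα, h20, h21] using e02
  have h31 : υ 3 1 = 0 := by simpa [hα, h20, h21, h30] using e11
  have h40 : υ 4 0 = 0 := by simpa [hα, h20, h21, h22, h30] using e20
  rintro ⟨m, n⟩ hq
  have hmn := mem_Lam.1 hq
  simp only at hmn ⊢
  have hm : m ≤ 4 := by omega
  have hn : n ≤ 4 := by omega
  interval_cases m <;> interval_cases n <;> first | omega | simp only [*]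

/-- The solution of the differentiated equations splits into the parts due to the free quantities
and to the source. -/
theorem JetEq.split {α φ υ : ℕ → ℕ → ℝ} (hα : α 0 0 ≠ 0) (h : JetEq α φ υ) :
    ∀ q ∈ Lam 4, υ q.1 q.2 = reduce α (fun _ _ => 0) υ q.1 q.2 + ∑ s ∈ Lam 2, φ s.1 s.2 *
      reduce α (fun i j => if (i, j) = (s.1, s.2) then 1 else 0) (fun _ _ => 0) q.1 q.2 := by
  have h1 := (h.sub (jetEq_reduce hα (fun _ _ => 0) υ)).sub
    -- Superposition: subtracting the homogeneous part and the responses to unit sources leaves a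
    -- solution with no source on `Lam 2` and no free quantities, hence zero.
    (JetEq.sum (Lam 2) (fun s => φ s.1 s.2) fun s _ =>
      jetEq_reduce hα (fun i j => if (i, j) = (s.1, s.2) then 1 else 0) (fun _ _ => 0))
  have h2 := (h1.congr_source (φ' := fun _ _ => 0) (fun q hq => by
    simp [hq])).eq_zero hα (fun n => by simp [reduce_zero]) (fun n => by simp [reduce_one])
  intro q hq
  linear_combination h2 q hq

/-! ### The order conditions -/

/-- The coefficient of `h ^ d` in `rawCoeff α h k l`. -/
noncomputable def rawCoeffPart (α : ℕ → ℕ → ℝ) (k l : ℤ) (d : ℕ) : ℝ :=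
  match k, l, d with
  | -1, -1, 3 => -11 * (α 1 2 + α 2 1 + α 0 3 + α 3 0) * α 0 0 ^ 2
      + ((22 * α 0 2 + 35 * α 2 0 + 11 * α 1 1) * α 0 1
        + (11 * α 0 2 + 46 * α 2 0 + 11 * α 1 1) * α 1 0) * α 0 0
      - 11 * α 0 1 ^ 3 + α 0 1 ^ 2 * α 1 0 - 47 * α 0 1 * α 1 0 ^ 2 - 59 * α 1 0 ^ 3
  | -1, -1, 2 => ((22 * α 0 2 - 24 * α 2 0 + 46 * α 1 1) * α 0 0 + α 0 1 ^ 2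
      - 71 * α 0 1 * α 1 0 + 48 * α 1 0 ^ 2) * α 0 0
  | -1, -1, 1 => 2 * (α 0 1 - 11 * α 1 0) * α 0 0 ^ 2
  | -1, -1, 0 => 20 * α 0 0 ^ 3
  | -1, 0, 3 => 11 * (α 0 3 + α 2 1) * α 0 0 ^ 2
      - ((22 * α 0 2 + 35 * α 2 0) * α 0 1 + 11 * α 1 0 * α 1 1) * α 0 0
      + 11 * α 0 1 ^ 3 - 12 * α 0 1 ^ 2 * α 1 0 + 59 * α 0 1 * α 1 0 ^ 2
  | -1, 0, 2 => -((44 * α 0 2 - 44 * α 2 0 + 48 * α 1 1) * α 0 0 + 2 * α 0 1 ^ 2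
      - 96 * α 0 1 * α 1 0 + 22 * α 1 0 ^ 2) * α 0 0
  | -1, 0, 1 => -88 * α 0 0 ^ 2 * α 1 0
  | -1, 0, 0 => 80 * α 0 0 ^ 3
  | -1, 1, 2 => α 0 0 * ((22 * α 0 2 - 24 * α 2 0 + 2 * α 1 1) * α 0 0
      + (α 0 1 - α 1 0) * (α 0 1 - 48 * α 1 0))
  | -1, 1, 1 => 22 * (α 0 1 - α 1 0) * α 0 0 ^ 2
  | -1, 1, 0 => 20 * α 0 0 ^ 3
  | 0, -1, 3 => 11 * (α 3 0 + α 1 2) * α 0 0 ^ 2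
      - ((11 * α 0 2 + 46 * α 2 0) * α 1 0 + 11 * α 0 1 * α 1 1) * α 0 0
      + 11 * α 0 1 ^ 2 * α 1 0 - 12 * α 0 1 * α 1 0 ^ 2 + 59 * α 1 0 ^ 3
  | 0, -1, 2 => -(48 * α 0 0 * α 1 1 + 24 * α 0 1 * (α 0 1 - 4 * α 1 0)) * α 0 0
  | 0, -1, 1 => -(44 * α 0 1 + 48 * α 1 0) * α 0 0 ^ 2
  | 0, -1, 0 => 88 * α 0 0 ^ 3
  | 0, 0, 2 => α 0 0 * ((4 * α 2 0 + 48 * α 1 1) * α 0 0 + 24 * α 0 1 ^ 2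
      - 72 * α 0 1 * α 1 0 - 74 * α 1 0 ^ 2)
  | 0, 0, 1 => -(48 * α 0 1 - 228 * α 1 0) * α 0 0 ^ 2
  | 0, 0, 0 => -440 * α 0 0 ^ 3
  | 0, 1, 1 => (44 * α 0 1 - 48 * α 1 0) * α 0 0 ^ 2
  | 0, 1, 0 => 88 * α 0 0 ^ 3
  | 1, -1, 0 => 24 * α 0 0 ^ 3
  | 1, 0, 0 => 96 * α 0 0 ^ 3
  | 1, 1, 1 => 24 * α 0 0 ^ 2 * α 0 1
  | 1, 1, 0 => 24 * α 0 0 ^ 3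
  | _, _, _ => 0

theorem stencil_eq : stencil = {-1, 0, 1} := by decide

theorem sum_stencil (g : ℤ → ℝ) : ∑ k ∈ stencil, g k = g (-1) + g 0 + g 1 := by
  rw [stencil_eq]
  simp [add_assoc]

theorem rawCoeff_eq_sum (α : ℕ → ℕ → ℝ) (h : ℝ) {k l : ℤ} (hk : k ∈ stencil) (hl : l ∈ stencil) :
    rawCoeff α h k l = ∑ d ∈ Finset.range 4, rawCoeffPart α k l d * h ^ d := by
  simp only [stencil_eq, Finset.mem_insert, Finset.mem_singleton] at hk hl
  rcases hk with rfl | rfl | rfl <;> rcases hl with rfl | rfl | rfl <;>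
    simp only [rawCoeff, rawCoeffPart, Finset.sum_range_succ, Finset.sum_range_zero] <;> ring

/-- The homogeneous part of degree `e` of the Taylor polynomial with derivatives `υ`. -/
noncomputable def taylorPart (υ : ℕ → ℕ → ℝ) (e : ℕ) (x y : ℝ) : ℝ :=
  ∑ i ∈ Finset.range (e + 1),
    υ i (e - i) / ((i.factorial : ℝ) * ((e - i).factorial : ℝ)) * x ^ i * y ^ (e - i)

theorem sum_Lam (K : ℕ) (g : ℕ × ℕ → ℝ) :
    ∑ q ∈ Lam K, g q = ∑ e ∈ Finset.range (K + 1), ∑ i ∈ Finset.range (e + 1), g (i, e - i) := by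
  rw [Finset.sum_sigma']
  refine Finset.sum_bij' (fun q _ => ⟨q.1 + q.2, q.1⟩) (fun s _ => (s.2, s.1 - s.2)) ?_ ?_ ?_ ?_ ?_
  · intro q hq
    have := mem_Lam.1 hq
    simp only [Finset.mem_sigma, Finset.mem_range]
    omega
  · rintro ⟨e, i⟩ hs
    simp only [Finset.mem_sigma, Finset.mem_range] at hs
    rw [mem_Lam]
    simp only
    omega
  · rintro ⟨i, j⟩ _
    simp
  · rintro ⟨e, i⟩ hs
    simp only [Finset.mem_sigma, Finset.mem_range] at hs
    have : i + (e - i) = e := by omega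
    simp [this]
  · rintro ⟨i, j⟩ _
    simp

theorem taylorPart_mul (υ : ℕ → ℕ → ℝ) (e : ℕ) (x y h : ℝ) :
    taylorPart υ e (x * h) (y * h) = taylorPart υ e x y * h ^ e := by
  rw [taylorPart, taylorPart, Finset.sum_mul]
  refine Finset.sum_congr rfl fun i hi => ?_
  have : h ^ e = h ^ i * h ^ (e - i) := by
    rw [← pow_add]
    congr 1
    have := Finset.mem_range.1 hi
    omega
  rw [this, mul_pow, mul_pow]
  ring

theorem sum_Lam_taylor (υ : ℕ → ℕ → ℝ) (K : ℕ) (x y h : ℝ) :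
    ∑ q ∈ Lam K, υ q.1 q.2 / ((q.1.factorial : ℝ) * (q.2.factorial : ℝ)) * (x * h) ^ q.1
      * (y * h) ^ q.2 = ∑ e ∈ Finset.range (K + 1), taylorPart υ e x y * h ^ e := by
  rw [sum_Lam]
  exact Finset.sum_congr rfl fun e _ => by rw [← taylorPart_mul]; rfl

/-- The contribution of order `d + e` in `h` of the parts of orders `d` of the coefficients and `e`
of the Taylor polynomial. -/
noncomputable def stencilPart (α υ : ℕ → ℕ → ℝ) (d e : ℕ) : ℝ :=
  ∑ k ∈ stencil, ∑ l ∈ stencil, rawCoeffPart α k l d * taylorPart υ e k l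

-- The raw coefficients are homogeneous of degree three in the derivatives of `a`. Writing these as
-- `A * b i j` with `b 0 0 = 1` makes the elimination free of denominators, so each order condition
-- becomes a polynomial identity.
set_option maxHeartbeats 4000000 in
theorem order_conditions_scaled (A : ℝ) (b υ : ℕ → ℕ → ℝ) (hb : b 0 0 = 1)
    (e00 : υ 2 0 = -(υ 0 2 + b 1 0 * υ 1 0 + b 0 1 * υ 0 1))
    (e10 : υ 3 0 = -(b 1 0 * (υ 2 0 + υ 0 2) + υ 1 2 + b 2 0 * υ 1 0 + b 1 0 * υ 2 0
      + b 1 1 * υ 0 1 + b 0 1 * υ 1 1))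
    (e01 : υ 2 1 = -(b 0 1 * (υ 2 0 + υ 0 2) + υ 0 3 + b 1 1 * υ 1 0 + b 1 0 * υ 1 1
      + b 0 2 * υ 0 1 + b 0 1 * υ 0 2))
    (e20 : υ 4 0 = -(b 2 0 * (υ 2 0 + υ 0 2) + 2 * b 1 0 * (υ 3 0 + υ 1 2) + υ 2 2
      + b 3 0 * υ 1 0 + 2 * b 2 0 * υ 2 0 + b 1 0 * υ 3 0
      + b 2 1 * υ 0 1 + 2 * b 1 1 * υ 1 1 + b 0 1 * υ 2 1))
    (e11 : υ 3 1 = -(b 1 1 * (υ 2 0 + υ 0 2) + b 1 0 * (υ 2 1 + υ 0 3) + b 0 1 * (υ 3 0 + υ 1 2)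
      + υ 1 3 + b 2 1 * υ 1 0 + b 2 0 * υ 1 1 + b 1 1 * υ 2 0 + b 1 0 * υ 2 1
      + b 1 2 * υ 0 1 + b 1 1 * υ 0 2 + b 0 2 * υ 1 1 + b 0 1 * υ 1 2))
    (e02 : υ 2 2 = -(b 0 2 * (υ 2 0 + υ 0 2) + 2 * b 0 1 * (υ 2 1 + υ 0 3) + υ 0 4
      + b 1 2 * υ 1 0 + 2 * b 1 1 * υ 1 1 + b 1 0 * υ 1 2
      + b 0 3 * υ 0 1 + 2 * b 0 2 * υ 0 2 + b 0 1 * υ 0 3)) :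
    stencilPart (fun i j => A * b i j) υ 0 0 = 0 ∧
    stencilPart (fun i j => A * b i j) υ 0 1 + stencilPart (fun i j => A * b i j) υ 1 0
      = 24 * A ^ 3 * υ 1 0 ∧
    stencilPart (fun i j => A * b i j) υ 0 2 + stencilPart (fun i j => A * b i j) υ 1 1
      + stencilPart (fun i j => A * b i j) υ 2 0 = 0 ∧
    stencilPart (fun i j => A * b i j) υ 0 3 + stencilPart (fun i j => A * b i j) υ 1 2
      + stencilPart (fun i j => A * b i j) υ 2 1 + stencilPart (fun i j => A * b i j) υ 3 0 = 0 ∧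
    stencilPart (fun i j => A * b i j) υ 0 4 + stencilPart (fun i j => A * b i j) υ 1 3
      + stencilPart (fun i j => A * b i j) υ 2 2 + stencilPart (fun i j => A * b i j) υ 3 1 = 0 := by
  refine ⟨?_, ?_, ?_, ?_, ?_⟩ <;>
  · simp only [stencilPart, sum_stencil, rawCoeffPart, taylorPart, Finset.sum_range_succ,
      Finset.sum_range_zero, Nat.factorial, hb, Nat.sub_zero, Nat.reduceSub, Nat.reduceAdd]
    push_cast
    -- After substitution only `A`, `b` and the free quantities `υ 0 n`, `υ 1 n` remain. The
    -- conditions of orders zero and one contain no eliminated derivative, hence the `try`.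
    try simp only [e20, e11, e02, e10, e01, e00]
    ring

theorem order_conditions {α υ : ℕ → ℕ → ℝ} (hα : α 0 0 ≠ 0) (h : JetEq α (fun _ _ => 0) υ) :
    stencilPart α υ 0 0 = 0 ∧
    stencilPart α υ 0 1 + stencilPart α υ 1 0 = 24 * α 0 0 ^ 3 * υ 1 0 ∧
    stencilPart α υ 0 2 + stencilPart α υ 1 1 + stencilPart α υ 2 0 = 0 ∧
    stencilPart α υ 0 3 + stencilPart α υ 1 2 + stencilPart α υ 2 1 + stencilPart α υ 3 0 = 0 ∧
    stencilPart α υ 0 4 + stencilPart α υ 1 3 + stencilPart α υ 2 2 + stencilPart α υ 3 1 = 0 := by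
  obtain ⟨e00, e10, e01, e20, e11, e02⟩ := h
  have hαb : α = fun i j => α 0 0 * (α i j / α 0 0) := by
    funext i j
    field_simp
  have key := order_conditions_scaled (α 0 0) (fun i j => α i j / α 0 0) υ (div_self hα)
    (by field_simp; linear_combination e00) (by field_simp; linear_combination e10)
    (by field_simp; linear_combination e01) (by field_simp; linear_combination e20)
    (by field_simp; linear_combination e11) (by field_simp; linear_combination e02)
  rwa [← hαb] at key

/-- The coefficient of `h ^ 5` in the consistency error, itself a polynomial in `h`. -/
noncomputable def consistencyError (α υ : ℕ → ℕ → ℝ) (h : ℝ) : ℝ :=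
  (stencilPart α υ 1 4 + stencilPart α υ 2 3 + stencilPart α υ 3 2
    + (stencilPart α υ 2 4 + stencilPart α υ 3 3) * h + stencilPart α υ 3 4 * h ^ 2)
    / (24 * α 0 0 ^ 3)

/-- Sorting the product of coefficients and Taylor polynomial by powers of `h`, orders zero to four
are the order conditions, and orders five to seven make up `consistencyError`. -/
theorem sum_gradCoeff_taylor {α υ : ℕ → ℕ → ℝ} (hα : α 0 0 ≠ 0)
    (hυ : JetEq α (fun _ _ => 0) υ) (h : ℝ) :
    ∑ k ∈ stencil, ∑ l ∈ stencil, gradCoeff α h k l * ∑ q ∈ Lam 4,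
      υ q.1 q.2 / ((q.1.factorial : ℝ) * (q.2.factorial : ℝ)) * (k * h) ^ q.1 * (l * h) ^ q.2
      = h * υ 1 0 + h ^ 5 * consistencyError α υ h := by
  obtain ⟨h0, h1, h2, h3, h4⟩ := order_conditions hα hυ
  have hsum : ∑ k ∈ stencil, ∑ l ∈ stencil, gradCoeff α h k l * ∑ q ∈ Lam 4,
      υ q.1 q.2 / ((q.1.factorial : ℝ) * (q.2.factorial : ℝ)) * (k * h) ^ q.1 * (l * h) ^ q.2
      = (∑ d ∈ Finset.range 4, ∑ e ∈ Finset.range 5, stencilPart α υ d e * h ^ (d + e))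
        / (24 * α 0 0 ^ 3) := by
    have : ∀ k ∈ stencil, ∀ l ∈ stencil, gradCoeff α h k l * ∑ q ∈ Lam 4,
        υ q.1 q.2 / ((q.1.factorial : ℝ) * (q.2.factorial : ℝ)) * (k * h) ^ q.1 * (l * h) ^ q.2
        = (∑ d ∈ Finset.range 4, ∑ e ∈ Finset.range 5,
          rawCoeffPart α k l d * taylorPart υ e k l * h ^ (d + e)) / (24 * α 0 0 ^ 3) := by
      intro k hk l hl
      rw [sum_Lam_taylor, gradCoeff, rawCoeff_eq_sum α h hk hl, div_mul_eq_mul_div,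
        Finset.sum_mul_sum]
      congr 1
      refine Finset.sum_congr rfl fun d _ => Finset.sum_congr rfl fun e _ => ?_
      ring
    rw [Finset.sum_congr rfl fun k hk => Finset.sum_congr rfl fun l hl => this k hk l hl]
    simp only [← Finset.sum_div, stencilPart, Finset.sum_mul]
    congr 1
    rw [Finset.sum_congr rfl fun k _ => Finset.sum_comm, Finset.sum_comm]
    refine Finset.sum_congr rfl fun d _ => ?_
    rw [Finset.sum_congr rfl fun k _ => Finset.sum_comm, Finset.sum_comm]
  rw [hsum, consistencyError]
  simp only [Finset.sum_range_succ, Finset.sum_range_zero]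
  field_simp
  linear_combination h0 + h * h1 + h ^ 2 * h2 + h ^ 3 * h3 + h ^ 4 * h4

/-- If `v` differs from the Taylor polynomial of `υ` by `ρ`, then the formula gives `υ 1 0` up to the
consistency error and the contribution of `ρ`. -/
theorem gradX_eq {α φ υ : ℕ → ℕ → ℝ} (hα : α 0 0 ≠ 0) (hυ : JetEq α φ υ) (v ρ : ℤ → ℤ → ℝ)
    {h : ℝ} (hh : h ≠ 0) (hv : ∀ k ∈ stencil, ∀ l ∈ stencil, v k l = ρ k l + ∑ q ∈ Lam 4,
      υ q.1 q.2 / ((q.1.factorial : ℝ) * (q.2.factorial : ℝ)) * (k * h) ^ q.1 * (l * h) ^ q.2) :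
    gradX α φ v h - υ 1 0 = h ^ 4 * consistencyError α (reduce α (fun _ _ => 0) υ) h
      + 1 / h * ∑ k ∈ stencil, ∑ l ∈ stencil, gradCoeff α h k l * ρ k l := by
  have hs := sum_gradCoeff_taylor hα (jetEq_reduce hα (fun _ _ => 0) υ) h
  rw [reduce_one] at hs
  -- The source correction is the stencil applied to the source part of the Taylor polynomial;
  -- `hsplit` exhibits the same quantity in the nodal values, and the two cancel.
  have hf : ∑ q ∈ Lam 2, φ q.1 q.2 * gradSourceCoeff α h q.1 q.2
      = ∑ k ∈ stencil, ∑ l ∈ stencil, gradCoeff α h k l *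
        ∑ s ∈ Lam 2, φ s.1 s.2 * polyH α 4 s.1 s.2 (k * h) (l * h) := by
    simp only [gradSourceCoeff, Finset.mul_sum]
    rw [Finset.sum_comm]
    refine Finset.sum_congr rfl fun k _ => ?_
    rw [Finset.sum_comm]
    refine Finset.sum_congr rfl fun l _ => Finset.sum_congr rfl fun s _ => ?_
    ring
  have hsplit : ∀ k ∈ stencil, ∀ l ∈ stencil, gradCoeff α h k l * v k l
      = gradCoeff α h k l * ρ k l + gradCoeff α h k l * ∑ q ∈ Lam 4,
        reduce α (fun _ _ => 0) υ q.1 q.2 / ((q.1.factorial : ℝ) * (q.2.factorial : ℝ))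
          * (k * h) ^ q.1 * (l * h) ^ q.2
        + gradCoeff α h k l * ∑ s ∈ Lam 2, φ s.1 s.2 * polyH α 4 s.1 s.2 (k * h) (l * h) := by
    intro k hk l hl
    rw [hv k hk l hl, ← mul_add, ← mul_add, add_assoc]
    congr 2
    simp only [polyH, Finset.mul_sum]
    rw [Finset.sum_comm, ← Finset.sum_add_distrib]
    refine Finset.sum_congr rfl fun q hq => ?_
    rw [hυ.split hα q hq, add_div, Finset.sum_div, add_mul, add_mul, Finset.sum_mul,
      Finset.sum_mul]
    congr 1
    refine Finset.sum_congr rfl fun s _ => ?_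
    ring
  rw [gradX, hf, Finset.sum_congr rfl fun k hk => Finset.sum_congr rfl fun l hl => hsplit k hk l hl]
  simp only [Finset.sum_add_distrib]
  rw [hs]
  field_simp
  ring

/-! ### Taylor expansion with uniform remainder -/

/-- The derivative of a Taylor remainder is the remainder of one order less for the derivative, so
the mean value inequality on the unit interval carries the bound upwards. The factor `1 / n!` is
given away. -/
theorem abs_sub_taylor_le {M : ℝ} (n : ℕ) : ∀ g : ℕ → ℝ → ℝ,
    (∀ r < n, ∀ t ∈ Icc (0 : ℝ) 1, HasDerivAt (g r) (g (r + 1) t) t) →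
    (∀ t ∈ Icc (0 : ℝ) 1, |g n t| ≤ M) → ∀ t ∈ Icc (0 : ℝ) 1,
      |g 0 t - ∑ r ∈ Finset.range n, g r 0 / (r.factorial : ℝ) * t ^ r| ≤ M := by
  induction n with
  | zero => intro g _ hM t ht; simpa using hM t ht
  | succ n ih =>
    intro g hg hM t ht
    have ih' := ih (fun r => g (r + 1)) (fun r hr => hg (r + 1) (by omega)) hM
    set F : ℝ → ℝ := fun t => g 0 t - ∑ r ∈ Finset.range (n + 1), g r 0 / (r.factorial : ℝ) * t ^ r
      with hF
    have hd : ∀ x ∈ Icc (0 : ℝ) 1, HasDerivWithinAt F (g 1 x - ∑ r ∈ Finset.range n,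
        g (r + 1) 0 / (r.factorial : ℝ) * x ^ r) (Icc 0 1) x := by
      intro x hx
      refine HasDerivAt.hasDerivWithinAt ?_
      refine (hg 0 (by omega) x hx).sub ?_
      have hs : HasDerivAt (fun t => ∑ r ∈ Finset.range (n + 1),
          g r 0 / (r.factorial : ℝ) * t ^ r) (∑ r ∈ Finset.range (n + 1),
          g r 0 / (r.factorial : ℝ) * (r * x ^ (r - 1))) x :=
        HasDerivAt.fun_sum fun r _ => (hasDerivAt_pow r x).const_mul _
      refine hs.congr_deriv ?_
      rw [Finset.sum_range_succ']
      simp only [Nat.cast_zero, zero_mul, mul_zero, add_zero, Nat.add_sub_cancel]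
      refine Finset.sum_congr rfl fun r _ => ?_
      rw [Nat.factorial_succ]
      push_cast
      field_simp
    have := (convex_Icc (0 : ℝ) 1).norm_image_sub_le_of_norm_hasDerivWithin_le hd
      (fun x hx => ih' x hx) (left_mem_Icc.2 zero_le_one) ht
    have hF0 : F 0 = 0 := by
      rw [hF]
      simp only [Finset.sum_range_succ', zero_pow (Nat.succ_ne_zero _)]
      simp
    have hM0 : 0 ≤ M := (abs_nonneg _).trans (hM t ht)
    rw [hF0, sub_zero, sub_zero, Real.norm_eq_abs, Real.norm_eq_abs, abs_of_nonneg ht.1] at this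
    exact this.trans (mul_le_of_le_one_right hM0 ht.2)

theorem hasDerivAt_jet_segment {V : Set (ℝ × ℝ)} (hV : IsOpen V) {w : ℝ × ℝ → ℝ} {m n : ℕ}
    (h : ContDiffOn ℝ (1 + m + n : ℕ) w V) {p : ℝ × ℝ} {x y t : ℝ}
    (hp : (p.1 + t * x, p.2 + t * y) ∈ V) :
    HasDerivAt (fun t : ℝ => jet w (p.1 + t * x, p.2 + t * y) m n)
      (x * jet w (p.1 + t * x, p.2 + t * y) (m + 1) n
        + y * jet w (p.1 + t * x, p.2 + t * y) m (n + 1)) t := by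
  set q : ℝ × ℝ := (p.1 + t * x, p.2 + t * y)
  have hd : DifferentiableAt ℝ (fun q => jet w q m n) q :=
    ((ContDiffOn.jet hV h).differentiableOn (by norm_num)).differentiableAt (hV.mem_nhds hp)
  have hγ : HasDerivAt (fun t : ℝ => (p.1 + t * x, p.2 + t * y)) (x, y) t := by
    refine HasDerivAt.prodMk ?_ ?_
    · simpa using ((hasDerivAt_id t).mul_const x).const_add p.1
    · simpa using ((hasDerivAt_id t).mul_const y).const_add p.2
  have := HasFDerivAt.comp_hasDerivAt (f := fun t : ℝ => (p.1 + t * x, p.2 + t * y)) t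
    hd.hasFDerivAt hγ
  refine this.congr_deriv ?_
  rw [← partialX_jet, ← partialY_jet hV (by rwa [add_comm m 1]) hp, partialX_eq_fderiv hd,
    partialY_eq_fderiv hd]
  have : (x, y) = x • ((1 : ℝ), (0 : ℝ)) + y • ((0 : ℝ), (1 : ℝ)) := by simp
  rw [this, map_add, map_smul, map_smul, smul_eq_mul, smul_eq_mul]

theorem exists_taylor_bound {V K : Set (ℝ × ℝ)} (hV : IsOpen V) (hK : IsCompact K) (hKV : K ⊆ V)
    {u : ℝ × ℝ → ℝ} (hu : ContDiffOn ℝ 5 u V) :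
    ∃ B : ℝ, ∀ (p : ℝ × ℝ) (x y h : ℝ), |x| ≤ h → |y| ≤ h →
      (∀ t ∈ Icc (0 : ℝ) 1, (p.1 + t * x, p.2 + t * y) ∈ K) →
      |u (p.1 + x, p.2 + y) - ∑ q ∈ Lam 4,
        jet u p q.1 q.2 / ((q.1.factorial : ℝ) * (q.2.factorial : ℝ)) * x ^ q.1 * y ^ q.2|
        ≤ B * h ^ 5 := by
  have hc : ∀ k m n : ℕ, k + m + n ≤ 5 → ContDiffOn ℝ (k + m + n : ℕ) u V := fun k m n hmn =>
    hu.of_le (by exact_mod_cast hmn)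
  have hcont : ContinuousOn (fun q => ∑ i ∈ Finset.range 6, |jet u q i (5 - i)|) K := by
    refine continuousOn_finsetSum _ fun i hi => ContinuousOn.abs ?_
    have hi' := Finset.mem_range.1 hi
    exact ((ContDiffOn.jet hV (hc 0 i (5 - i) (by omega))).continuousOn).mono hKV
  obtain ⟨B, hB⟩ := hK.exists_bound_of_continuousOn hcont
  -- `B` bounds every fifth order derivative on `K`, and `32 = 2 ^ 5` is the sum of the binomial
  -- coefficients in the fifth derivative along a segment.
  refine ⟨32 * B, fun p x y h hx hy hseg => ?_⟩
  -- `g r` is the `r`-th derivative of `u` along the segment from `p` to `p + (x, y)`; the recursion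
  -- `g r' = g (r + 1)` is Pascal's rule.
  set g : ℕ → ℝ → ℝ := fun r t => ∑ i ∈ Finset.range (r + 1), (r.choose i : ℝ) *
    (x ^ i * y ^ (r - i) * jet u (p.1 + t * x, p.2 + t * y) i (r - i)) with hg
  have hh : 0 ≤ h := (abs_nonneg x).trans hx
  have hderiv : ∀ r < 5, ∀ t ∈ Icc (0 : ℝ) 1, HasDerivAt (g r) (g (r + 1) t) t := by
    intro r hr t ht
    have h1 : HasDerivAt (g r) (∑ i ∈ Finset.range (r + 1), (r.choose i : ℝ) *
        (x ^ i * y ^ (r - i) * (x * jet u (p.1 + t * x, p.2 + t * y) (i + 1) (r - i)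
          + y * jet u (p.1 + t * x, p.2 + t * y) i (r - i + 1)))) t := by
      refine HasDerivAt.fun_sum fun i hi => ?_
      have hi' := Finset.mem_range.1 hi
      exact ((hasDerivAt_jet_segment hV (hc 1 i (r - i) (by omega))
        (hKV (hseg t ht))).const_mul _).const_mul _
    convert h1 using 1
    rw [hg]
    simp only
    rw [Finset.sum_choose_succ_mul
      (fun i j => x ^ i * y ^ j * jet u (p.1 + t * x, p.2 + t * y) i j) r,
      ← Finset.sum_add_distrib]
    refine Finset.sum_congr rfl fun i hi => ?_
    have hi' := Finset.mem_range.1 hi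
    rw [show r + 1 - i = r - i + 1 by omega]
    ring
  have hbound : ∀ t ∈ Icc (0 : ℝ) 1, |g 5 t| ≤ 32 * B * h ^ 5 := by
    intro t ht
    have hBt := hB _ (hseg t ht)
    rw [Real.norm_eq_abs, abs_of_nonneg (Finset.sum_nonneg fun _ _ => abs_nonneg _)] at hBt
    have hle : ∀ i ∈ Finset.range 6, |((5 : ℕ).choose i : ℝ) * (x ^ i * y ^ (5 - i) *
        jet u (p.1 + t * x, p.2 + t * y) i (5 - i))| ≤ ((5 : ℕ).choose i : ℝ) * (h ^ 5 * B) := by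
      intro i hi
      have hi' := Finset.mem_range.1 hi
      rw [abs_mul, abs_mul, abs_mul, abs_pow, abs_pow, Nat.abs_cast]
      have hxy : |x| ^ i * |y| ^ (5 - i) ≤ h ^ 5 := by
        have : h ^ 5 = h ^ i * h ^ (5 - i) := by rw [← pow_add]; congr 1; omega
        rw [this]
        gcongr
      have hj : |jet u (p.1 + t * x, p.2 + t * y) i (5 - i)| ≤ B :=
        (Finset.single_le_sum (f := fun i => |jet u (p.1 + t * x, p.2 + t * y) i (5 - i)|)
          (fun _ _ => abs_nonneg _) hi).trans hBt
      gcongr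
    refine (Finset.abs_sum_le_sum_abs _ _).trans ((Finset.sum_le_sum hle).trans (le_of_eq ?_))
    rw [← Finset.sum_mul]
    have h32 : ∑ i ∈ Finset.range (5 + 1), ((5 : ℕ).choose i : ℝ) = 32 := by
      rw [← Nat.cast_sum, Nat.sum_range_choose]
      norm_num
    rw [h32]
    ring
  have := abs_sub_taylor_le 5 g hderiv hbound 1 (right_mem_Icc.2 zero_le_one)
  have hg0 : g 0 1 = u (p.1 + x, p.2 + y) := by
    simp [hg, jet]
  have hsum : ∑ r ∈ Finset.range 5, g r 0 / (r.factorial : ℝ) * 1 ^ r = ∑ q ∈ Lam 4,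
      jet u p q.1 q.2 / ((q.1.factorial : ℝ) * (q.2.factorial : ℝ)) * x ^ q.1 * y ^ q.2 := by
    rw [sum_Lam]
    refine Finset.sum_congr rfl fun r _ => ?_
    rw [one_pow, mul_one, hg]
    simp only [zero_mul, add_zero, Finset.sum_div]
    refine Finset.sum_congr rfl fun i hi => ?_
    have hi' := Finset.mem_range.1 hi
    rw [Nat.cast_choose ℝ (show i ≤ r by omega)]
    have := Nat.factorial_ne_zero r
    field_simp
  rwa [hg0, hsum] at this

/-! ### Uniform consistency -/

section Uniform

variable {X : Type*} [TopologicalSpace X] {S : Set X} {α φ υ : X → ℕ → ℕ → ℝ}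

/-- The two nested inductions follow the recursion: first the total order, then the order in `x`.
Only `u^(m,n+2)` has the same total order as `u^(m+2,n)`. -/
theorem continuousOn_reduce (hα : ∀ m n, ContinuousOn (fun p => α p m n) S)
    (hα0 : ∀ p ∈ S, α p 0 0 ≠ 0) {N : ℕ} (hφ : ∀ m n, ContinuousOn (fun p => φ p m n) S)
    (hυ : ∀ m n, m + n ≤ N → ContinuousOn (fun p => υ p m n) S) : ∀ m n, m + n ≤ N →
      ContinuousOn (fun p => reduce (α p) (φ p) (υ p) m n) S := by
  suffices h : ∀ K, ∀ m n, m + n ≤ K → K ≤ N →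
      ContinuousOn (fun p => reduce (α p) (φ p) (υ p) m n) S from
    fun m n hmn => h N m n hmn le_rfl
  intro K
  induction K using Nat.strong_induction_on with
  | _ K ihK =>
  intro m
  induction m using Nat.strong_induction_on with
  | _ m ihm =>
  intro n hmn hKN
  rcases m with _ | _ | m
  · simpa only [reduce_zero] using hυ 0 n (hmn.trans hKN)
  · simpa only [zero_add, reduce_one] using hυ 1 n (by omega)
  · have hlow : ∀ i j, i + j < K → ContinuousOn (fun p => reduce (α p) (φ p) (υ p) i j) S :=
      fun i j hij => ihK (i + j) hij i j le_rfl (by omega)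
    have h0 := ihm m (by omega) (n + 2) (by omega) hKN
    have hrec : (fun p => reduce (α p) (φ p) (υ p) (m + 2) n) = fun p =>
        -reduce (α p) (φ p) (υ p) m (n + 2)
          - (φ p m n + ∑ i : Fin (m + 1), ∑ j : Fin (n + 1),
              (m.choose i : ℝ) * (n.choose j : ℝ) *
                ((if _h : (i : ℕ) + (j : ℕ) = 0 then 0
                  else α p i j * (reduce (α p) (φ p) (υ p) (m - i + 2) (n - j)
                    + reduce (α p) (φ p) (υ p) (m - i) (n - j + 2)))
                + α p (i + 1) j * reduce (α p) (φ p) (υ p) (m - i + 1) (n - j)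
                + α p i (j + 1) * reduce (α p) (φ p) (υ p) (m - i) (n - j + 1))) / α p 0 0 := by
      funext p
      rw [reduce]
    rw [hrec]
    refine h0.neg.sub (ContinuousOn.div ?_ (hα 0 0) hα0)
    refine (hφ m n).add (continuousOn_finsetSum _ fun i _ => continuousOn_finsetSum _ fun j _ => ?_)
    refine continuousOn_const.mul (((?_ : ContinuousOn _ S).add ((hα _ _).mul (hlow _ _ ?_))).add
      ((hα _ _).mul (hlow _ _ ?_)))
    · split_ifs with hij
      · exact continuousOn_const
      · exact (hα _ _).mul ((hlow _ _ (by omega)).add (hlow _ _ (by omega)))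
    · omega
    · omega

theorem continuousOn_rawCoeffPart (hα : ∀ m n, ContinuousOn (fun p => α p m n) S) (k l : ℤ)
    (d : ℕ) : ContinuousOn (fun p => rawCoeffPart (α p) k l d) S := by
  unfold rawCoeffPart
  split <;> fun_prop

theorem continuousOn_stencilPart (hα : ∀ m n, ContinuousOn (fun p => α p m n) S)
    (d e : ℕ) (hυ : ∀ m n, m + n ≤ e → ContinuousOn (fun p => υ p m n) S) :
    ContinuousOn (fun p => stencilPart (α p) (υ p) d e) S := by
  refine continuousOn_finsetSum _ fun k _ => continuousOn_finsetSum _ fun l _ =>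
    (continuousOn_rawCoeffPart hα k l d).mul (continuousOn_finsetSum _ fun i hi => ?_)
  have := hυ i (e - i) (by have := Finset.mem_range.1 hi; omega)
  fun_prop

theorem exists_bound_consistencyError (hS : IsCompact S)
    (hα : ∀ m n, ContinuousOn (fun p => α p m n) S) (hα0 : ∀ p ∈ S, α p 0 0 ≠ 0)
    (hυ : ∀ m n, m + n ≤ 4 → ContinuousOn (fun p => υ p m n) S) (H : ℝ) :
    ∃ M, ∀ p ∈ S, ∀ h ∈ Icc 0 H, |consistencyError (α p) (υ p) h| ≤ M := by
  have hs : ∀ d e, e ≤ 4 →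
      ContinuousOn (fun z : X × ℝ => stencilPart (α z.1) (υ z.1) d e) (S ×ˢ Icc 0 H) :=
    fun d e he => (continuousOn_stencilPart hα d e fun m n hmn => hυ m n (by omega)).comp
      continuousOn_fst fun z hz => hz.1
  have h00 : ContinuousOn (fun z : X × ℝ => α z.1 0 0) (S ×ˢ Icc 0 H) :=
    (hα 0 0).comp continuousOn_fst fun z hz => hz.1
  have hc : ContinuousOn (fun z : X × ℝ => consistencyError (α z.1) (υ z.1) z.2)
      (S ×ˢ Icc 0 H) := by
    have h14 := hs 1 4 (by norm_num)
    have h23 := hs 2 3 (by norm_num)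
    have h32 := hs 3 2 (by norm_num)
    have h24 := hs 2 4 (by norm_num)
    have h33 := hs 3 3 (by norm_num)
    have h34 := hs 3 4 (by norm_num)
    unfold consistencyError
    refine ContinuousOn.div (by fun_prop) (continuousOn_const.mul (h00.pow 3)) fun z hz => ?_
    have := hα0 z.1 hz.1
    positivity
  obtain ⟨M, hM⟩ := (hS.prod isCompact_Icc).exists_bound_of_continuousOn hc
  exact ⟨M, fun p hp h hh => hM (p, h) ⟨hp, hh⟩⟩

theorem exists_bound_gradCoeff (hS : IsCompact S)
    (hα : ∀ m n, ContinuousOn (fun p => α p m n) S) (hα0 : ∀ p ∈ S, α p 0 0 ≠ 0) (H : ℝ) :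
    ∃ M, ∀ p ∈ S, ∀ h ∈ Icc 0 H, ∑ k ∈ stencil, ∑ l ∈ stencil, |gradCoeff (α p) h k l| ≤ M := by
  have hr : ∀ k l d, ContinuousOn (fun z : X × ℝ => rawCoeffPart (α z.1) k l d) (S ×ˢ Icc 0 H) :=
    fun k l d => (continuousOn_rawCoeffPart hα k l d).comp continuousOn_fst fun z hz => hz.1
  have h00 : ContinuousOn (fun z : X × ℝ => α z.1 0 0) (S ×ˢ Icc 0 H) :=
    (hα 0 0).comp continuousOn_fst fun z hz => hz.1
  have hc : ContinuousOn (fun z : X × ℝ => ∑ k ∈ stencil, ∑ l ∈ stencil,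
      |gradCoeff (α z.1) z.2 k l|) (S ×ˢ Icc 0 H) := by
    refine continuousOn_finsetSum _ fun k hk => continuousOn_finsetSum _ fun l hl =>
      ContinuousOn.abs ?_
    simp only [gradCoeff, rawCoeff_eq_sum _ _ hk hl]
    refine ContinuousOn.div (continuousOn_finsetSum _ fun d _ => ?_) 
      (continuousOn_const.mul (h00.pow 3)) fun z hz => ?_
    · have := hr k l d
      fun_prop
    · have := hα0 z.1 hz.1
      positivity
  obtain ⟨M, hM⟩ := (hS.prod isCompact_Icc).exists_bound_of_continuousOn hc
  exact ⟨M, fun p hp h hh => (le_abs_self _).trans (hM (p, h) ⟨hp, hh⟩)⟩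

/-- The two terms of `gradX_eq` are bounded separately: the consistency error by compactness in `(p,
h)`, the Taylor remainder by the sum of the weights. Because the source part has cancelled exactly,
`φ` enters only through the equations. The derivatives are arbitrary families over `X`, so the lemma
also applies with the variables exchanged. -/
theorem exists_gradX_bound (hS : IsCompact S)
    (hα : ∀ m n, ContinuousOn (fun p => α p m n) S) (hα0 : ∀ p ∈ S, α p 0 0 ≠ 0)
    (hυ : ∀ m n, m + n ≤ 4 → ContinuousOn (fun p => υ p m n) S)
    (heq : ∀ p ∈ S, JetEq (α p) (φ p) (υ p)) (B H : ℝ) :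
    ∃ C > 0, ∀ p ∈ S, ∀ h, 0 < h → h ≤ H → ∀ v : ℤ → ℤ → ℝ,
      (∀ k ∈ stencil, ∀ l ∈ stencil, |v k l - ∑ q ∈ Lam 4, υ p q.1 q.2 /
        ((q.1.factorial : ℝ) * (q.2.factorial : ℝ)) * (k * h) ^ q.1 * (l * h) ^ q.2|
          ≤ B * h ^ 5) →
      |gradX (α p) (φ p) v h - υ p 1 0| ≤ C * h ^ 4 := by
  obtain ⟨M₁, hM₁⟩ := exists_bound_consistencyError hS hα hα0
    (continuousOn_reduce hα hα0 (φ := fun _ _ _ => 0) (fun _ _ => continuousOn_const) hυ) H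
  obtain ⟨M₂, hM₂⟩ := exists_bound_gradCoeff hS hα hα0 H
  refine ⟨|M₁| + |M₂| * |B| + 1, by positivity, fun p hp h hh hhH v hv => ?_⟩
  have hmem : h ∈ Icc 0 H := ⟨hh.le, hhH⟩
  rw [gradX_eq (hα0 p hp) (heq p hp) v (fun k l => v k l - ∑ q ∈ Lam 4, υ p q.1 q.2 /
    ((q.1.factorial : ℝ) * (q.2.factorial : ℝ)) * (k * h) ^ q.1 * (l * h) ^ q.2) hh.ne'
    (fun k _ l _ => by ring)]
  have h1 : |h ^ 4 * consistencyError (α p) (reduce (α p) (fun _ _ => 0) (υ p)) h|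
      ≤ |M₁| * h ^ 4 := by
    rw [abs_mul, abs_of_pos (pow_pos hh 4), mul_comm]
    exact mul_le_mul_of_nonneg_right ((hM₁ p hp h hmem).trans (le_abs_self _)) (by positivity)
  have h2 : |1 / h * ∑ k ∈ stencil, ∑ l ∈ stencil, gradCoeff (α p) h k l *
      (v k l - ∑ q ∈ Lam 4, υ p q.1 q.2 / ((q.1.factorial : ℝ) * (q.2.factorial : ℝ))
        * (k * h) ^ q.1 * (l * h) ^ q.2)| ≤ |M₂| * |B| * h ^ 4 := by
    rw [abs_mul, abs_of_pos (one_div_pos.2 hh)]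
    have h3 : |∑ k ∈ stencil, ∑ l ∈ stencil, gradCoeff (α p) h k l *
        (v k l - ∑ q ∈ Lam 4, υ p q.1 q.2 / ((q.1.factorial : ℝ) * (q.2.factorial : ℝ))
          * (k * h) ^ q.1 * (l * h) ^ q.2)|
        ≤ (∑ k ∈ stencil, ∑ l ∈ stencil, |gradCoeff (α p) h k l|) * (|B| * h ^ 5) := by
      rw [Finset.sum_mul]
      refine (Finset.abs_sum_le_sum_abs _ _).trans (Finset.sum_le_sum fun k hk => ?_)
      rw [Finset.sum_mul]
      refine (Finset.abs_sum_le_sum_abs _ _).trans (Finset.sum_le_sum fun l hl => ?_)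
      rw [abs_mul]
      refine mul_le_mul_of_nonneg_left ((hv k hk l hl).trans ?_) (abs_nonneg _)
      gcongr
      exact le_abs_self _
    calc 1 / h * _ ≤ 1 / h * (|M₂| * (|B| * h ^ 5)) := by
          gcongr
          refine h3.trans ?_
          gcongr
          exact (hM₂ p hp h hmem).trans (le_abs_self _)
      _ = |M₂| * |B| * h ^ 4 := by field_simp
  refine (abs_add_le _ _).trans ((add_le_add h1 h2).trans ?_)
  nlinarith [pow_pos hh 4]

end Uniform

/-- Uniform fourth order consistency of the formulas for both partial derivatives at the points of a
compact set where the differentiated equations hold. -/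
theorem exists_gradient_bound {V K S : Set (ℝ × ℝ)} (hV : IsOpen V) (hK : IsCompact K)
    (hKV : K ⊆ V) (hS : IsCompact S) (hSV : S ⊆ V) {a f u : ℝ × ℝ → ℝ}
    (ha : ContDiffOn ℝ ∞ a V) (hu : ContDiffOn ℝ 5 u V) (ha0 : ∀ p ∈ S, a p ≠ 0)
    (heq : ∀ p ∈ S, JetEq (jet a p) (jet f p) (jet u p)) (H : ℝ) :
    ∃ C > 0, ∀ p ∈ S, ∀ h, 0 < h → h ≤ H →
      Icc (p.1 - h) (p.1 + h) ×ˢ Icc (p.2 - h) (p.2 + h) ⊆ K →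
      |gradX (jet a p) (jet f p) (fun k l => u (node p h k l)) h - partialX u p| ≤ C * h ^ 4 ∧
      |gradY (jet a p) (jet f p) (fun k l => u (node p h k l)) h - partialY u p| ≤ C * h ^ 4 := by
  obtain ⟨B, hB⟩ := exists_taylor_bound hV hK hKV hu
  have hja : ∀ m n, ContinuousOn (fun p => jet a p m n) S := fun m n =>
    ((ContDiffOn.jet hV (k := 0) (ha.of_le (by exact_mod_cast le_top))).continuousOn).mono hSV
  have hju : ∀ m n, m + n ≤ 4 → ContinuousOn (fun p => jet u p m n) S := fun m n hmn => by
    have : 0 + m + n ≤ 5 := by omega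
    exact ((ContDiffOn.jet hV (k := 0) (hu.of_le (by exact_mod_cast this))).continuousOn).mono hSV
  obtain ⟨C₁, hC₁, h₁⟩ := exists_gradX_bound hS hja ha0 hju heq B H
  obtain ⟨C₂, hC₂, h₂⟩ := exists_gradX_bound hS (fun m n => hja n m) ha0
    (fun m n hmn => hju n m (by omega)) (fun p hp => (heq p hp).swap) B H
  have hTaylor : ∀ p ∈ S, ∀ h, 0 < h → Icc (p.1 - h) (p.1 + h) ×ˢ Icc (p.2 - h) (p.2 + h) ⊆ K →
      ∀ k ∈ stencil, ∀ l ∈ stencil, |u (node p h k l) - ∑ q ∈ Lam 4, jet u p q.1 q.2 /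
        ((q.1.factorial : ℝ) * (q.2.factorial : ℝ)) * (k * h) ^ q.1 * (l * h) ^ q.2|
          ≤ B * h ^ 5 := by
    intro p _ h hh hbox k hk l hl
    have habs : ∀ k ∈ stencil, |(k : ℝ) * h| ≤ h := by
      intro k hk
      have hk' : |(k : ℝ)| ≤ 1 := by
        have := Finset.mem_Icc.1 hk
        exact abs_le.2 (by exact_mod_cast this)
      rw [abs_mul, abs_of_pos hh]
      exact mul_le_of_le_one_left hh.le hk'
    -- The segment from the centre to a node stays in the box of half-width `h`.
    refine hB p (k * h) (l * h) h (habs k hk) (habs l hl) fun t ht => hbox ?_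
    have hseg : ∀ z : ℝ, |z| ≤ h → |t * z| ≤ h := fun z hz => by
      rw [abs_mul, abs_of_nonneg ht.1]
      exact (mul_le_of_le_one_left (abs_nonneg z) ht.2).trans hz
    have hx := abs_le.1 (hseg _ (habs k hk))
    have hy := abs_le.1 (hseg _ (habs l hl))
    exact ⟨⟨by linarith [hx.1], by linarith [hx.2]⟩, ⟨by linarith [hy.1], by linarith [hy.2]⟩⟩
  refine ⟨max C₁ C₂, lt_max_of_lt_left hC₁, fun p hp h hh hhH hbox => ⟨?_, ?_⟩⟩
  · refine (h₁ p hp h hh hhH _ (hTaylor p hp h hh hbox)).trans ?_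
    gcongr
    exact le_max_left _ _
  · refine (h₂ p hp h hh hhH (fun k l => u (node p h l k)) fun k hk l hl => ?_).trans ?_
    · convert hTaylor p hp h hh hbox l hl k hk using 3
      refine Finset.sum_bij' (fun q _ => q.swap) (fun q _ => q.swap) ?_ ?_ (by simp) (by simp) ?_
      · exact fun q hq => mem_Lam.2 (by have := mem_Lam.1 hq; simp only [Prod.swap]; omega)
      · exact fun q hq => mem_Lam.2 (by have := mem_Lam.1 hq; simp only [Prod.swap]; omega)
      · intro q _
        simp only [Prod.fst_swap, Prod.snd_swap]
        ring
    · gcongr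
      exact le_max_right _ _

/-! ### Fourth order at regular points -/

theorem five_le_infty : (5 : WithTop ℕ∞) ≤ ∞ := by
  have h : ∀ n : ℕ, (n : WithTop ℕ∞) ≤ ∞ := fun n => by exact_mod_cast le_top
  exact h 5

theorem isOpen_rect (l₁ l₂ l₃ l₄ : ℝ) : IsOpen (rect l₁ l₂ l₃ l₄) := isOpen_Ioo.prod isOpen_Ioo

theorem isOpen_offInterface {Ω : Set (ℝ × ℝ)} (hΩ : IsOpen Ω) {ψ : ℝ × ℝ → ℝ}
    (hψ : Continuous ψ) : IsOpen (offInterface Ω ψ) :=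
  hΩ.inter (isOpen_ne_fun hψ continuous_const)

theorem Side.isOpen_region (s : Side) {Ω : Set (ℝ × ℝ)} (hΩ : IsOpen Ω) {ψ : ℝ × ℝ → ℝ}
    (hψ : Continuous ψ) : IsOpen (s.region Ω ψ) := by
  cases s
  · exact hΩ.inter (isOpen_lt continuous_const hψ)
  · exact hΩ.inter (isOpen_lt hψ continuous_const)

theorem Side.region_subset_offInterface (s : Side) (Ω : Set (ℝ × ℝ)) (ψ : ℝ × ℝ → ℝ) :
    s.region Ω ψ ⊆ offInterface Ω ψ := by
  cases s
  · exact fun p hp => ⟨hp.1, ne_of_gt hp.2⟩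
  · exact fun p hp => ⟨hp.1, ne_of_lt hp.2⟩

theorem node_mem_box (p : ℝ × ℝ) {h : ℝ} (hh : 0 ≤ h) {k l : ℤ} (hk : k ∈ stencil)
    (hl : l ∈ stencil) : node p h k l ∈ Icc (p.1 - h) (p.1 + h) ×ˢ Icc (p.2 - h) (p.2 + h) := by
  have hb : ∀ k ∈ stencil, -h ≤ (k : ℝ) * h ∧ (k : ℝ) * h ≤ h := by
    intro k hk
    have hk' := Finset.mem_Icc.1 hk
    have h1 : (-1 : ℝ) ≤ k := by exact_mod_cast hk'.1
    have h2 : (k : ℝ) ≤ 1 := by exact_mod_cast hk'.2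
    constructor <;> nlinarith
  have hx := hb k hk
  have hy := hb l hl
  exact ⟨⟨by simp only [node]; linarith, by simp only [node]; linarith⟩,
    ⟨by simp only [node]; linarith, by simp only [node]; linarith⟩⟩

/-- The box is connected, so by the intermediate value theorem `ψ` keeps the sign it has at the
centre. -/
theorem isRegularPoint_of_box {ψ : ℝ × ℝ → ℝ} (hψ : Continuous ψ) {p : ℝ × ℝ} {h : ℝ}
    (hh : 0 ≤ h) (hbox : ∀ q ∈ Icc (p.1 - h) (p.1 + h) ×ˢ Icc (p.2 - h) (p.2 + h), ψ q ≠ 0) :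
    IsRegularPoint ψ p h := by
  set Q := Icc (p.1 - h) (p.1 + h) ×ˢ Icc (p.2 - h) (p.2 + h) with hQ
  have hpQ : p ∈ Q := ⟨⟨by linarith, by linarith⟩, ⟨by linarith, by linarith⟩⟩
  have hconn : IsPreconnected Q := isPreconnected_Icc.prod isPreconnected_Icc
  rcases lt_or_ge (ψ p) 0 with hp | hp
  · refine ⟨Side.minus, fun k hk l hl => ?_⟩
    change ψ _ < 0
    by_contra! hn
    obtain ⟨q, hq, hq0⟩ := hconn.intermediate_value hpQ (node_mem_box p hh hk hl)
      hψ.continuousOn ⟨hp.le, hn⟩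
    exact hbox q hq hq0
  · refine ⟨Side.plus, fun k hk l hl => ?_⟩
    change 0 ≤ ψ _
    by_contra! hn
    obtain ⟨q, hq, hq0⟩ := hconn.intermediate_value (node_mem_box p hh hk hl) hpQ
      hψ.continuousOn ⟨hn.le, hp⟩
    exact hbox q hq hq0

theorem exists_local_gradient_bound {V S : Set (ℝ × ℝ)} (hV : IsOpen V) (hS : IsCompact S)
    (hSV : S ⊆ V) {a f u : ℝ × ℝ → ℝ} (ha : ContDiffOn ℝ ∞ a V) (hu : ContDiffOn ℝ 5 u V)
    (ha0 : ∀ p ∈ V, a p ≠ 0) (hpde : SolvesOn a u f V) :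
    ∃ C > 0, ∃ δ > 0, ∀ p ∈ S, ∀ h : ℝ, 0 < h → h ≤ δ →
      Icc (p.1 - h) (p.1 + h) ×ˢ Icc (p.2 - h) (p.2 + h) ⊆ V ∧
      |gradX (jet a p) (jet f p) (fun k l => u (node p h k l)) h - partialX u p| ≤ C * h ^ 4 ∧
      |gradY (jet a p) (jet f p) (fun k l => u (node p h k l)) h - partialY u p| ≤ C * h ^ 4 := by
  -- In the sup metric of the plane the boxes are closed balls, so a closed thickening of `S` inside
  -- `V` contains all stencils of mesh size at most `δ`.
  obtain ⟨δ, hδ, hδV⟩ := hS.exists_cthickening_subset_open hV hSV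
  have ha5 : ContDiffOn ℝ 5 a V := ha.of_le five_le_infty
  obtain ⟨C, hC, hb⟩ := exists_gradient_bound hV (hS.cthickening (r := δ)) hδV hS hSV ha hu
    (fun p hp => ha0 p (hSV hp)) (fun p hp => hpde.jetEq hV ha5 hu (hSV hp)) δ
  refine ⟨C, hC, δ, hδ, fun p hp h hh hhδ => ?_⟩
  have hbox : Icc (p.1 - h) (p.1 + h) ×ˢ Icc (p.2 - h) (p.2 + h) ⊆ Metric.cthickening δ S := by
    rintro q ⟨⟨h1, h2⟩, ⟨h3, h4⟩⟩
    refine Metric.mem_cthickening_of_dist_le q p δ S hp (le_trans ?_ hhδ)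
    rw [Prod.dist_eq, Real.dist_eq, Real.dist_eq]
    exact max_le (abs_le.2 ⟨by linarith, by linarith⟩) (abs_le.2 ⟨by linarith, by linarith⟩)
  exact ⟨hbox.trans hδV, hb p hp h hh hhδ hbox⟩

/-! ### Uniformity up to the interface -/

/-- Each equation is an identity between continuous functions of the point, as it involves
derivatives of `U` of order at most four; the set where it holds is therefore closed. -/
theorem JetEq.of_mem_closure {R : Set (ℝ × ℝ)} {A F U : ℝ × ℝ → ℝ} (hA : ContDiff ℝ ∞ A)
    (hF : ContDiff ℝ ∞ F) (hU : ContDiff ℝ 5 U)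
    (h : ∀ q ∈ R, JetEq (jet A q) (jet F q) (jet U q)) {p : ℝ × ℝ} (hp : p ∈ closure R) :
    JetEq (jet A p) (jet F p) (jet U p) := by
  have hs : ∀ {w : ℝ × ℝ → ℝ}, ContDiff ℝ ∞ w → ∀ m n, Continuous fun q => jet w q m n :=
    fun hw m n => continuousOn_univ.1
      (ContDiffOn.jet isOpen_univ (k := 0) (hw.contDiffOn.of_le
        (by exact_mod_cast le_top))).continuousOn
  have hjA := hs hA
  have hjF := hs hF
  have hjU : ∀ m n, m + n ≤ 4 → Continuous fun q => jet U q m n := fun m n hmn => by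
    have : 0 + m + n ≤ 5 := by omega
    exact continuousOn_univ.1 (ContDiffOn.jet isOpen_univ (k := 0) (hU.contDiffOn.of_le
        (by exact_mod_cast this))).continuousOn
  have h20 := hjU 2 0 (by norm_num)
  have h02 := hjU 0 2 (by norm_num)
  have h10 := hjU 1 0 (by norm_num)
  have h01 := hjU 0 1 (by norm_num)
  have h11 := hjU 1 1 (by norm_num)
  have h30 := hjU 3 0 (by norm_num)
  have h21 := hjU 2 1 (by norm_num)
  have h12 := hjU 1 2 (by norm_num)
  have h03 := hjU 0 3 (by norm_num)
  have h40 := hjU 4 0 (by norm_num)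
  have h31 := hjU 3 1 (by norm_num)
  have h22 := hjU 2 2 (by norm_num)
  have h13 := hjU 1 3 (by norm_num)
  have h04 := hjU 0 4 (by norm_num)
  exact ⟨closure_minimal (fun q hq => (h q hq).e00) (isClosed_eq (by fun_prop) (by fun_prop)) hp,
    closure_minimal (fun q hq => (h q hq).e10) (isClosed_eq (by fun_prop) (by fun_prop)) hp,
    closure_minimal (fun q hq => (h q hq).e01) (isClosed_eq (by fun_prop) (by fun_prop)) hp,
    closure_minimal (fun q hq => (h q hq).e20) (isClosed_eq (by fun_prop) (by fun_prop)) hp,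
    closure_minimal (fun q hq => (h q hq).e11) (isClosed_eq (by fun_prop) (by fun_prop)) hp,
    closure_minimal (fun q hq => (h q hq).e02) (isClosed_eq (by fun_prop) (by fun_prop)) hp⟩

/-- A short step from `p` in a direction of increase of `ψ` reaches the positive side. This handles
centres lying on the interface itself, which count as plus points. -/
theorem mem_closure_pos_of_fderiv_ne_zero {Ω : Set (ℝ × ℝ)} (hΩ : IsOpen Ω) {ψ : ℝ × ℝ → ℝ}
    {p : ℝ × ℝ} (hp : p ∈ Ω) (h0 : ψ p = 0) (hd : fderiv ℝ ψ p ≠ 0) :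
    p ∈ closure {q ∈ Ω | 0 < ψ q} := by
  obtain ⟨v, hv⟩ : ∃ v, 0 < fderiv ℝ ψ p v := by
    obtain ⟨v, hv⟩ : ∃ v, fderiv ℝ ψ p v ≠ 0 := by
      by_contra! hn
      exact hd (ContinuousLinearMap.ext hn)
    rcases lt_or_gt_of_ne hv with hv | hv
    · exact ⟨-v, by simpa using hv⟩
    · exact ⟨v, hv⟩
  have hdiff : DifferentiableAt ℝ ψ p := by
    by_contra hn
    exact hd (fderiv_zero_of_not_differentiableAt hn)
  have hγ : HasDerivAt (fun t : ℝ => p + t • v) v 0 := by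
    simpa using ((hasDerivAt_id (0 : ℝ)).smul_const v).const_add p
  have hderiv : HasDerivAt (fun t : ℝ => ψ (p + t • v)) (fderiv ℝ ψ p v) 0 :=
    HasFDerivAt.comp_hasDerivAt (f := fun t : ℝ => p + t • v) 0
      (by simpa using hdiff.hasFDerivAt) hγ
  have hpos := ((hasDerivAt_iff_tendsto_slope_zero.1 hderiv).mono_left
    (nhdsGT_le_nhdsNE 0)).eventually (lt_mem_nhds hv)
  have hcont : Tendsto (fun t : ℝ => p + t • v) (𝓝[>] 0) (𝓝 p) := by
    have := hγ.continuousAt.tendsto.mono_left (nhdsWithin_le_nhds (s := Ioi 0))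
    simpa using this
  refine mem_closure_of_tendsto hcont ?_
  filter_upwards [hpos, hcont (hΩ.mem_nhds hp), self_mem_nhdsWithin] with t ht htΩ ht0
  refine ⟨htΩ, ?_⟩
  simp only [zero_add, zero_smul, add_zero, h0, sub_zero, smul_eq_mul] at ht
  exact (mul_pos_iff_of_pos_left (inv_pos.2 ht0)).1 ht

theorem Side.mem_closure_region (s : Side) {Ω : Set (ℝ × ℝ)} (hΩ : IsOpen Ω) {ψ : ℝ × ℝ → ℝ}
    (hd : ∀ q ∈ Ω, ψ q = 0 → fderiv ℝ ψ q ≠ 0) {p : ℝ × ℝ} (hp : p ∈ Ω) (hs : p ∈ s.points ψ) :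
    p ∈ closure (s.region Ω ψ) := by
  cases s
  · rcases (show 0 ≤ ψ p from hs).lt_or_eq with h | h
    · exact subset_closure ⟨hp, h⟩
    · exact mem_closure_pos_of_fderiv_ne_zero hΩ hp h.symm (hd p hp h.symm)
  · exact subset_closure ⟨hp, hs⟩

theorem exists_gradient_bound_side {l₁ l₂ l₃ l₄ : ℝ} {ψ a f u : ℝ × ℝ → ℝ} (hψ : Continuous ψ)
    (ha : ContDiffOn ℝ ∞ a (offInterface (rect l₁ l₂ l₃ l₄) ψ))
    (hu : ContDiffOn ℝ 5 u (offInterface (rect l₁ l₂ l₃ l₄) ψ))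
    (hpde : SolvesOn a u f (offInterface (rect l₁ l₂ l₃ l₄) ψ))
    (hd : ∀ q ∈ rect l₁ l₂ l₃ l₄, ψ q = 0 → fderiv ℝ ψ q ≠ 0) (s : Side)
    {A F U : ℝ × ℝ → ℝ} (hA : ContDiff ℝ ∞ A) (hF : ContDiff ℝ ∞ F) (hU : ContDiff ℝ 5 U)
    (hAa : EqOn A a (s.region (rect l₁ l₂ l₃ l₄) ψ))
    (hFf : EqOn F f (s.region (rect l₁ l₂ l₃ l₄) ψ))
    (hUu : EqOn U u (s.region (rect l₁ l₂ l₃ l₄) ψ))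
    (hpos : ∀ q ∈ closure (s.region (rect l₁ l₂ l₃ l₄) ψ), 0 < A q) :
    ∃ C > 0, ∀ p : ℝ × ℝ, ∀ h : ℝ, 0 < h →
      (∀ k ∈ stencil, ∀ l ∈ stencil,
        node p h k l ∈ Icc l₁ l₂ ×ˢ Icc l₃ l₄ ∧ node p h k l ∈ s.points ψ) →
      |gradX (jet A p) (jet F p) (fun k l => U (node p h k l)) h - partialX U p| ≤ C * h ^ 4 ∧
      |gradY (jet A p) (jet F p) (fun k l => U (node p h k l)) h - partialY U p| ≤ C * h ^ 4 := by
  set V := offInterface (rect l₁ l₂ l₃ l₄) ψ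
  set R := s.region (rect l₁ l₂ l₃ l₄) ψ
  have hV : IsOpen V := isOpen_offInterface (isOpen_rect _ _ _ _) hψ
  have hR : IsOpen R := s.isOpen_region (isOpen_rect _ _ _ _) hψ
  have hRV : R ⊆ V := s.region_subset_offInterface _ _
  have hK : IsCompact (Icc l₁ l₂ ×ˢ Icc l₃ l₄) := isCompact_Icc.prod isCompact_Icc
  have hRK : closure R ⊆ Icc l₁ l₂ ×ˢ Icc l₃ l₄ :=
    closure_minimal (fun q hq => prod_mono Ioo_subset_Icc_self Ioo_subset_Icc_self (hRV hq).1)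
      hK.isClosed
  have heq : ∀ p ∈ closure R, JetEq (jet A p) (jet F p) (jet U p) := fun p hp =>
    JetEq.of_mem_closure hA hF hU (fun q hq => by
      rw [hAa.jet hR hq, hFf.jet hR hq, hUu.jet hR hq]
      exact hpde.jetEq hV (ha.of_le five_le_infty) hu (hRV hq)) hp
  -- The stencil box may cross the interface: the Taylor bound concerns `U`, which is `C^5` on the
  -- whole plane, while the equations are used only at the centre.
  obtain ⟨C, hC, hb⟩ := exists_gradient_bound isOpen_univ hK (subset_univ _)
    (hK.of_isClosed_subset isClosed_closure hRK) (subset_univ _) hA.contDiffOn hU.contDiffOn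
    (fun p hp => (hpos p hp).ne') heq (l₂ - l₁)
  refine ⟨C, hC, fun p h hh hn => ?_⟩
  have hlow := (hn (-1) (by decide) (-1) (by decide)).1
  have hup := (hn 1 (by decide) 1 (by decide)).1
  have hcen := (hn 0 (by decide) 0 (by decide)).2
  simp only [node, mem_prod, mem_Icc, Int.cast_neg, Int.cast_one, neg_mul, one_mul,
    Int.cast_zero, zero_mul, add_zero] at hlow hup hcen
  obtain ⟨⟨h1, _⟩, h3, _⟩ := hlow
  obtain ⟨⟨_, h2⟩, _, h4⟩ := hup
  -- Opposite corner nodes in the closed rectangle and `h > 0` put the centre strictly inside.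
  have hp : p ∈ rect l₁ l₂ l₃ l₄ := ⟨⟨by linarith, by linarith⟩, ⟨by linarith, by linarith⟩⟩
  exact hb p (s.mem_closure_region (isOpen_rect _ _ _ _) hd hp hcen) h hh (by linarith)
    (prod_mono (Icc_subset_Icc (by linarith) (by linarith))
      (Icc_subset_Icc (by linarith) (by linarith)))

/-! ### Existence of a fourth order scheme -/

theorem exists_gradCoeff_polynomial (α : ℕ → ℕ → ℝ) : ∃ P : ℤ → ℤ → Polynomial ℝ,
    (∀ k l, (P k l).natDegree ≤ 3) ∧
      ∀ k ∈ stencil, ∀ l ∈ stencil, ∀ h, (P k l).eval h = gradCoeff α h k l := by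
  refine ⟨fun k l => ∑ d ∈ Finset.range 4,
    Polynomial.C (rawCoeffPart α k l d / (24 * α 0 0 ^ 3)) * Polynomial.X ^ d, fun k l => ?_,
    fun k hk l hl h => ?_⟩
  · refine Polynomial.natDegree_sum_le_of_forall_le _ _ fun d hd => ?_
    exact (Polynomial.natDegree_C_mul_X_pow_le _ _).trans (by
      have := Finset.mem_range.1 hd; omega)
  · rw [gradCoeff, rawCoeff_eq_sum α h hk hl, Polynomial.eval_finsetSum, Finset.sum_div]
    refine Finset.sum_congr rfl fun d _ => ?_
    simp only [Polynomial.eval_mul, Polynomial.eval_C, Polynomial.eval_pow, Polynomial.eval_X]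
    ring

theorem exists_gradSourceCoeff_polynomial (α : ℕ → ℕ → ℝ) (m n : ℕ) : ∃ P : Polynomial ℝ,
    ∀ h, P.eval h = gradSourceCoeff α h m n := by
  obtain ⟨P, -, hP⟩ := exists_gradCoeff_polynomial α
  refine ⟨∑ k ∈ stencil, ∑ l ∈ stencil, P k l * ∑ q ∈ Lam 4, Polynomial.C
    (reduce α (fun i j => if (i, j) = (m, n) then 1 else 0) (fun _ _ => 0) q.1 q.2
      / ((q.1.factorial : ℝ) * (q.2.factorial : ℝ))) * (Polynomial.C (k : ℝ) * Polynomial.X) ^ q.1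
      * (Polynomial.C (l : ℝ) * Polynomial.X) ^ q.2, fun h => ?_⟩
  rw [gradSourceCoeff, Polynomial.eval_finsetSum]
  refine Finset.sum_congr rfl fun k hk => ?_
  rw [Polynomial.eval_finsetSum]
  refine Finset.sum_congr rfl fun l hl => ?_
  rw [Polynomial.eval_mul, hP k hk l hl, Polynomial.eval_finsetSum, polyH]
  simp only [Polynomial.eval_mul, Polynomial.eval_C, Polynomial.eval_pow, Polynomial.eval_X]

/-- The source coefficients are cubic weights times quartic Taylor polynomials, so they may exceed
degree four. Reducing modulo `X ^ 5` costs only `O(h ^ 5)`, the permitted error for `M = 3`. -/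
theorem exists_truncated_polynomial (P : Polynomial ℝ) : ∃ T : Polynomial ℝ, T.natDegree ≤ 4 ∧
    (fun h : ℝ => T.eval h - P.eval h) =O[𝓝[>] 0] fun h : ℝ => h ^ 5 := by
  have hm : (Polynomial.X ^ 5 : Polynomial ℝ).Monic := Polynomial.monic_X_pow 5
  refine ⟨P %ₘ Polynomial.X ^ 5, ?_, ?_⟩
  · have := Polynomial.natDegree_modByMonic_lt P hm (by
      intro h
      have := congrArg Polynomial.natDegree h
      simp at this)
    rw [Polynomial.natDegree_X_pow] at this
    omega
  · have h1 : (fun h : ℝ => (P %ₘ Polynomial.X ^ 5).eval h - P.eval h)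
        = fun h : ℝ => h ^ 5 * -(P /ₘ Polynomial.X ^ 5).eval h := by
      funext h
      have := congrArg (Polynomial.eval h) (Polynomial.modByMonic_add_div P (Polynomial.X ^ 5))
      simp only [Polynomial.eval_add, Polynomial.eval_mul, Polynomial.eval_pow,
        Polynomial.eval_X] at this
      linear_combination this
    rw [h1]
    have h2 : (fun h : ℝ => -(P /ₘ Polynomial.X ^ 5).eval h) =O[𝓝[>] 0] fun _ => (1 : ℝ) :=
      (((P /ₘ Polynomial.X ^ 5).continuous.neg.tendsto 0).mono_left nhdsWithin_le_nhds).isBigO_one ℝ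
    simpa using (isBigO_refl (fun h : ℝ => h ^ 5) (𝓝[>] 0)).mul h2

theorem mul_gradX (α φ : ℕ → ℕ → ℝ) (v : ℤ → ℤ → ℝ) {h : ℝ} (hh : h ≠ 0) :
    h * gradX α φ v h = ∑ k ∈ stencil, ∑ l ∈ stencil, gradCoeff α h k l * v k l
      - ∑ q ∈ Lam 2, φ q.1 q.2 * gradSourceCoeff α h q.1 q.2 := by
  rw [gradX]
  field_simp

theorem mul_gradY (α φ : ℕ → ℕ → ℝ) (v : ℤ → ℤ → ℝ) {h : ℝ} (hh : h ≠ 0) :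
    h * gradY α φ v h
      = ∑ k ∈ stencil, ∑ l ∈ stencil, gradCoeff (fun m n => α n m) h l k * v k l
      - ∑ q ∈ Lam 2, φ q.1 q.2 * gradSourceCoeff (fun m n => α n m) h q.2 q.1 := by
  rw [gradY, mul_gradX _ _ _ hh, Finset.sum_comm]
  congr 1
  refine Finset.sum_bij' (fun q _ => q.swap) (fun q _ => q.swap) ?_ ?_ (by simp) (by simp) (by simp)
  · exact fun q hq => mem_Lam.2 (by have := mem_Lam.1 hq; simp only [Prod.swap]; omega)
  · exact fun q hq => mem_Lam.2 (by have := mem_Lam.1 hq; simp only [Prod.swap]; omega)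

theorem isBigO_mul_of_bound {g : ℝ → ℝ} {C δ : ℝ} (hδ : 0 < δ)
    (hg : ∀ h, 0 < h → h ≤ δ → |g h| ≤ C * h ^ 4) :
    (fun h : ℝ => h * g h) =O[𝓝[>] 0] fun h : ℝ => h ^ 5 := by
  refine IsBigO.of_bound C ?_
  filter_upwards [Ioc_mem_nhdsGT hδ] with h hh
  have h1 := hg h hh.1 hh.2
  rw [Real.norm_eq_abs, Real.norm_eq_abs, abs_mul, abs_of_pos hh.1, abs_of_pos (pow_pos hh.1 5)]
  calc h * |g h| ≤ h * (C * h ^ 4) := mul_le_mul_of_nonneg_left h1 hh.1.le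
    _ = C * h ^ 5 := by ring

theorem exists_compactGradientScheme {V : Set (ℝ × ℝ)} (hV : IsOpen V) {a : ℝ × ℝ → ℝ}
    (ha : ContDiffOn ℝ ∞ a V) (ha0 : ∀ p ∈ V, a p ≠ 0) {p : ℝ × ℝ} (hp : p ∈ V) (θ : ℝ) :
    ∃ (C : ℤ → ℤ → Polynomial ℝ) (Cf : ℕ → ℕ → Polynomial ℝ),
      (∀ k l, (C k l).natDegree ≤ 4) ∧ (∀ m n, (Cf m n).natDegree ≤ 4) ∧
      IsCompactGradientScheme a V p θ 3 C Cf := by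
  set α := jet a p
  obtain ⟨P, hPdeg, hP⟩ := exists_gradCoeff_polynomial α
  obtain ⟨Q, hQdeg, hQ⟩ := exists_gradCoeff_polynomial fun m n => α n m
  choose P' hP' using exists_gradSourceCoeff_polynomial α
  choose Q' hQ' using exists_gradSourceCoeff_polynomial fun m n => α n m
  choose T hTdeg hT using exists_truncated_polynomial
  -- The directional scheme is the combination of the two gradient formulas with weights `cos θ` and
  -- `sin θ`; in the `y`-formula all index pairs are exchanged.
  refine ⟨fun k l => Polynomial.C (Real.cos θ) * P k l + Polynomial.C (Real.sin θ) * Q l k,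
    fun m n => Polynomial.C (Real.cos θ) * T (P' m n) + Polynomial.C (Real.sin θ) * T (Q' n m),
    fun k l => ?_, fun m n => ?_, fun u f hu hpde => ?_⟩
  · refine Polynomial.natDegree_add_le_of_degree_le ?_ ?_
    · exact (Polynomial.natDegree_C_mul_le _ _).trans ((hPdeg k l).trans (by norm_num))
    · exact (Polynomial.natDegree_C_mul_le _ _).trans ((hQdeg l k).trans (by norm_num))
  · refine Polynomial.natDegree_add_le_of_degree_le ?_ ?_
    · exact (Polynomial.natDegree_C_mul_le _ _).trans (hTdeg _)
    · exact (Polynomial.natDegree_C_mul_le _ _).trans (hTdeg _)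
  · obtain ⟨K, -, δ, hδ, hb⟩ := exists_local_gradient_bound hV (isCompact_singleton (x := p))
      (singleton_subset_iff.2 hp) ha (hu.contDiffOn.of_le five_le_infty) ha0 hpde
    have hfilter : (Lam 3).filter (fun q => q.1 + q.2 < 3) = Lam 2 := by
      ext q
      rw [Finset.mem_filter, mem_Lam, mem_Lam]
      omega
    have h1 := isBigO_mul_of_bound hδ fun h hh hhδ => (hb p rfl h hh hhδ).2.1
    have h2 := isBigO_mul_of_bound hδ fun h hh hhδ => (hb p rfl h hh hhδ).2.2
    have h3 : (fun h : ℝ => ∑ q ∈ Lam 2, jet f p q.1 q.2 *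
        (Real.cos θ * ((T (P' q.1 q.2)).eval h - (P' q.1 q.2).eval h)
          + Real.sin θ * ((T (Q' q.2 q.1)).eval h - (Q' q.2 q.1).eval h)))
        =O[𝓝[>] 0] fun h : ℝ => h ^ 5 :=
      IsBigO.fun_sum fun q _ => (((hT _).const_mul_left _).add ((hT _).const_mul_left _)).const_mul_left _
    refine (((h1.const_mul_left (-Real.cos θ)).add (h2.const_mul_left (-Real.sin θ))).add
      h3).congr' ?_ EventuallyEq.rfl
    filter_upwards [self_mem_nhdsWithin] with h hh
    have hh0 : h ≠ 0 := (show 0 < h from hh).ne'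
    have hX := mul_gradX α (jet f p) (fun k l => u (node p h k l)) hh0
    have hY := mul_gradY α (jet f p) (fun k l => u (node p h k l)) hh0
    have hsum : ∑ k ∈ stencil, ∑ l ∈ stencil, (Polynomial.C (Real.cos θ) * P k l
          + Polynomial.C (Real.sin θ) * Q l k).eval h * u (node p h k l)
        = Real.cos θ * ∑ k ∈ stencil, ∑ l ∈ stencil, gradCoeff α h k l * u (node p h k l)
          + Real.sin θ * ∑ k ∈ stencil, ∑ l ∈ stencil,
            gradCoeff (fun m n => α n m) h l k * u (node p h k l) := by
      simp only [Finset.mul_sum, ← Finset.sum_add_distrib]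
      refine Finset.sum_congr rfl fun k hk => Finset.sum_congr rfl fun l hl => ?_
      rw [Polynomial.eval_add, Polynomial.eval_mul, Polynomial.eval_mul, Polynomial.eval_C,
        Polynomial.eval_C, hP k hk l hl, hQ l hl k hk]
      ring
    have hsrc : ∑ q ∈ Lam 2, jet f p q.1 q.2 * (Polynomial.C (Real.cos θ) * T (P' q.1 q.2)
          + Polynomial.C (Real.sin θ) * T (Q' q.2 q.1)).eval h
        = Real.cos θ * ∑ q ∈ Lam 2, jet f p q.1 q.2 * gradSourceCoeff α h q.1 q.2
          + Real.sin θ * ∑ q ∈ Lam 2, jet f p q.1 q.2 *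
            gradSourceCoeff (fun m n => α n m) h q.2 q.1
          + ∑ q ∈ Lam 2, jet f p q.1 q.2 *
            (Real.cos θ * ((T (P' q.1 q.2)).eval h - (P' q.1 q.2).eval h)
              + Real.sin θ * ((T (Q' q.2 q.1)).eval h - (Q' q.2 q.1).eval h)) := by
      simp only [Finset.mul_sum, ← Finset.sum_add_distrib]
      refine Finset.sum_congr rfl fun q _ => ?_
      rw [Polynomial.eval_add, Polynomial.eval_mul, Polynomial.eval_mul, Polynomial.eval_C,
        Polynomial.eval_C, hP', hQ']
      ring
    rw [hfilter, hsum, hsrc]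
    linear_combination (-Real.cos θ) * hX - Real.sin θ * hY

/-! ### Functions vanishing to a given order at a point -/

theorem ContDiffOn.partialX_infty {w : ℝ × ℝ → ℝ} {V : Set (ℝ × ℝ)} (hV : IsOpen V)
    (hw : ContDiffOn ℝ ∞ w V) : ContDiffOn ℝ ∞ (_root_.partialX w) V := hw.partialX hV le_rfl

theorem ContDiffOn.partialY_infty {w : ℝ × ℝ → ℝ} {V : Set (ℝ × ℝ)} (hV : IsOpen V)
    (hw : ContDiffOn ℝ ∞ w V) : ContDiffOn ℝ ∞ (_root_.partialY w) V := hw.partialY hV le_rfl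

theorem ContDiffOn.differentiableAt_of_infty {w : ℝ × ℝ → ℝ} {V : Set (ℝ × ℝ)} (hV : IsOpen V)
    (hw : ContDiffOn ℝ ∞ w V) {p : ℝ × ℝ} (hp : p ∈ V) : DifferentiableAt ℝ w p :=
  (hw.differentiableOn (by simp)).differentiableAt (hV.mem_nhds hp)

theorem ContDiff.partialX_infty {w : ℝ × ℝ → ℝ} (hw : ContDiff ℝ ∞ w) :
    ContDiff ℝ ∞ (_root_.partialX w) :=
  contDiffOn_univ.1 (hw.contDiffOn.partialX_infty isOpen_univ)

theorem ContDiff.partialY_infty {w : ℝ × ℝ → ℝ} (hw : ContDiff ℝ ∞ w) :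
    ContDiff ℝ ∞ (_root_.partialY w) :=
  contDiffOn_univ.1 (hw.contDiffOn.partialY_infty isOpen_univ)

theorem partialX_add_mul {v w : ℝ × ℝ → ℝ} {p : ℝ × ℝ} (hv : DifferentiableAt ℝ v p) (c : ℝ)
    (hw : DifferentiableAt ℝ w p) :
    partialX (fun q => v q + c * w q) p = partialX v p + c * partialX w p := by
  rw [partialX_add hv (hw.const_mul c), partialX_mul (differentiableAt_const c) hw]
  simp [partialX]

theorem partialY_add_mul {v w : ℝ × ℝ → ℝ} {p : ℝ × ℝ} (hv : DifferentiableAt ℝ v p) (c : ℝ)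
    (hw : DifferentiableAt ℝ w p) :
    partialY (fun q => v q + c * w q) p = partialY v p + c * partialY w p := by
  rw [partialY_add hv (hw.const_mul c), partialY_mul (differentiableAt_const c) hw]
  simp [partialY]

/-- All partial derivatives of `g` of order less than `n` vanish at `p`. -/
def FlatAt (p : ℝ × ℝ) : ℕ → (ℝ × ℝ → ℝ) → Prop
  | 0, _ => True
  | n + 1, g => g p = 0 ∧ FlatAt p n (partialX g) ∧ FlatAt p n (partialY g)

theorem FlatAt.mono {p : ℝ × ℝ} {n : ℕ} : ∀ {m : ℕ} {g : ℝ × ℝ → ℝ}, FlatAt p n g → m ≤ n →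
    FlatAt p m g := by
  induction n with
  | zero => intro m g h hm; rwa [Nat.le_zero.1 hm]
  | succ n ih =>
    intro m g h hm
    cases m with
    | zero => trivial
    | succ m => exact ⟨h.1, ih h.2.1 (by omega), ih h.2.2 (by omega)⟩

theorem flatAt_zero (p : ℝ × ℝ) (n : ℕ) : FlatAt p n (fun _ => 0) := by
  induction n with
  | zero => trivial
  | succ n ih =>
    have hX : partialX (fun _ => 0) = fun _ => 0 := by funext; simp [partialX]
    have hY : partialY (fun _ => 0) = fun _ => 0 := by funext; simp [partialY]
    exact ⟨rfl, by rwa [hX], by rwa [hY]⟩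

theorem FlatAt.jet_eq_zero {p : ℝ × ℝ} {g : ℝ × ℝ → ℝ} {n i j : ℕ} (h : FlatAt p n g)
    (hij : i + j < n) : jet g p i j = 0 := by
  induction n generalizing g i j with
  | zero => omega
  | succ n ih =>
    rcases j with _ | j
    · have hX : ∀ (i n : ℕ) (g : ℝ × ℝ → ℝ), FlatAt p n g → i < n → jet g p i 0 = 0 := by
        intro i
        induction i with
        | zero =>
          rintro (_ | n) g hg hn
          · omega
          · exact hg.1
        | succ i ihi =>
          rintro (_ | n) g hg hn
          · omega
          · exact ihi n _ hg.2.1 (by omega)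
      exact hX i (n + 1) g h hij
    · rw [← jet_partialY]
      exact ih h.2.2 (by omega)

section Flat

variable {V : Set (ℝ × ℝ)} {p : ℝ × ℝ} {g w : ℝ × ℝ → ℝ} {n : ℕ}

theorem FlatAt.congr (hV : IsOpen V) (hp : p ∈ V) (h : FlatAt p n g) (hgw : EqOn g w V) :
    FlatAt p n w := by
  induction n generalizing g w with
  | zero => trivial
  | succ n ih =>
    exact ⟨(hgw hp).symm.trans h.1, ih h.2.1 (hgw.partialX hV), ih h.2.2 (hgw.partialY hV)⟩

theorem FlatAt.add_mul (hV : IsOpen V) (hp : p ∈ V) (hg : ContDiffOn ℝ ∞ g V)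
    (hw : ContDiffOn ℝ ∞ w V) (h : FlatAt p n g) (c : ℝ) (h' : FlatAt p n w) :
    FlatAt p n (fun q => g q + c * w q) := by
  induction n generalizing g w with
  | zero => trivial
  | succ n ih =>
    refine ⟨by simp [h.1, h'.1], ?_, ?_⟩
    · exact (ih (hg.partialX_infty hV) (hw.partialX_infty hV) h.2.1 h'.2.1).congr hV hp fun q hq =>
        (partialX_add_mul (hg.differentiableAt_of_infty hV hq) c
          (hw.differentiableAt_of_infty hV hq)).symm
    · exact (ih (hg.partialY_infty hV) (hw.partialY_infty hV) h.2.2 h'.2.2).congr hV hp fun q hq =>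
        (partialY_add_mul (hg.differentiableAt_of_infty hV hq) c
          (hw.differentiableAt_of_infty hV hq)).symm

theorem FlatAt.add (hV : IsOpen V) (hp : p ∈ V) (hg : ContDiffOn ℝ ∞ g V)
    (hw : ContDiffOn ℝ ∞ w V) (h : FlatAt p n g) (h' : FlatAt p n w) :
    FlatAt p n (fun q => g q + w q) := by
  simpa using h.add_mul hV hp hg hw 1 h'

theorem FlatAt.mul_left (hV : IsOpen V) (hp : p ∈ V) (hg : ContDiffOn ℝ ∞ g V)
    (hw : ContDiffOn ℝ ∞ w V) (h : FlatAt p n g) : FlatAt p n (fun q => w q * g q) := by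
  induction n generalizing g w with
  | zero => trivial
  | succ n ih =>
    refine ⟨by simp [h.1], ?_, ?_⟩
    · refine FlatAt.congr hV hp (g := fun q => partialX w q * g q + w q * partialX g q) ?_
        fun q hq => (partialX_mul (hw.differentiableAt_of_infty hV hq)
          (hg.differentiableAt_of_infty hV hq)).symm
      have hwX := hw.partialX_infty hV
      have hgX := hg.partialX_infty hV
      exact FlatAt.add hV hp (hwX.mul hg) (hw.mul hgX) (ih hg hwX (h.mono (by omega)))
        (ih hgX hw h.2.1)
    · refine FlatAt.congr hV hp (g := fun q => partialY w q * g q + w q * partialY g q) ?_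
        fun q hq => (partialY_mul (hw.differentiableAt_of_infty hV hq)
          (hg.differentiableAt_of_infty hV hq)).symm
      have hwY := hw.partialY_infty hV
      have hgY := hg.partialY_infty hV
      exact FlatAt.add hV hp (hwY.mul hg) (hw.mul hgY) (ih hg hwY (h.mono (by omega)))
        (ih hgY hw h.2.2)

/-- A factor vanishing at `p` gains one order. It is applied to `a - a p`, which freezes the leading
coefficient of the operator at `p`. -/
theorem FlatAt.mul_left_of_eq_zero (hV : IsOpen V) (hp : p ∈ V) (hg : ContDiffOn ℝ ∞ g V)
    (hw : ContDiffOn ℝ ∞ w V) (h : FlatAt p n g) (hw0 : w p = 0) :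
    FlatAt p (n + 1) (fun q => w q * g q) := by
  induction n generalizing g w with
  | zero => exact ⟨by simp [hw0], trivial, trivial⟩
  | succ n ih =>
    refine ⟨by simp [hw0], ?_, ?_⟩
    · refine FlatAt.congr hV hp (g := fun q => partialX w q * g q + w q * partialX g q) ?_
        fun q hq => (partialX_mul (hw.differentiableAt_of_infty hV hq)
          (hg.differentiableAt_of_infty hV hq)).symm
      have hwX := hw.partialX_infty hV
      have hgX := hg.partialX_infty hV
      exact FlatAt.add hV hp (hwX.mul hg) (hw.mul hgX) (h.mul_left hV hp hg hwX)
        (ih hgX hw h.2.1 hw0)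
    · refine FlatAt.congr hV hp (g := fun q => partialY w q * g q + w q * partialY g q) ?_
        fun q hq => (partialY_mul (hw.differentiableAt_of_infty hV hq)
          (hg.differentiableAt_of_infty hV hq)).symm
      have hwY := hw.partialY_infty hV
      have hgY := hg.partialY_infty hV
      exact FlatAt.add hV hp (hwY.mul hg) (hw.mul hgY) (h.mul_left hV hp hg hwY)
        (ih hgY hw h.2.2 hw0)

/-- `FlatAt` speaks of all words in `∂x` and `∂y`, `jet` only of the sorted ones; commuting
derivatives closes the gap. -/
theorem FlatAt.of_jet (hV : IsOpen V) (hp : p ∈ V) (hg : ContDiffOn ℝ ∞ g V)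
    (h : ∀ i j, i + j < n → jet g p i j = 0) : FlatAt p n g := by
  induction n generalizing g with
  | zero => trivial
  | succ n ih =>
    refine ⟨h 0 0 (by omega), ih (hg.partialX_infty hV) fun i j hij => ?_,
      ih (hg.partialY_infty hV) fun i j hij => ?_⟩
    · rw [jet_partialX hV (hg.of_le (by exact_mod_cast le_top)) hp]
      exact h _ _ (by omega)
    · rw [jet_partialY]
      exact h _ _ (by omega)

theorem iterate_partialX_infty (hV : IsOpen V) (hg : ContDiffOn ℝ ∞ g V) (m : ℕ) :
    ContDiffOn ℝ ∞ (partialX^[m] g) V := by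
  induction m with
  | zero => exact hg
  | succ m ih => rw [Function.iterate_succ_apply']; exact ih.partialX_infty hV

theorem iterate_partialY_infty (hV : IsOpen V) (hg : ContDiffOn ℝ ∞ g V) (m : ℕ) :
    ContDiffOn ℝ ∞ (partialY^[m] g) V := by
  induction m with
  | zero => exact hg
  | succ m ih => rw [Function.iterate_succ_apply']; exact ih.partialY_infty hV

theorem jet_add_mul (hV : IsOpen V) (hp : p ∈ V) (hg : ContDiffOn ℝ ∞ g V)
    (hw : ContDiffOn ℝ ∞ w V) (c : ℝ) (i j : ℕ) :
    jet (fun q => g q + c * w q) p i j = jet g p i j + c * jet w p i j := by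
  have hY : ∀ j, EqOn (partialY^[j] fun q => g q + c * w q)
      (fun q => partialY^[j] g q + c * partialY^[j] w q) V := by
    intro j
    induction j with
    | zero => exact eqOn_refl _ _
    | succ j ih =>
      simp only [Function.iterate_succ_apply']
      exact (ih.partialY hV).trans fun q hq => partialY_add_mul
        ((iterate_partialY_infty hV hg j).differentiableAt_of_infty hV hq) c
        ((iterate_partialY_infty hV hw j).differentiableAt_of_infty hV hq)
  have hX : ∀ i, EqOn (partialX^[i] fun q => partialY^[j] g q + c * partialY^[j] w q)
      (fun q => partialX^[i] (partialY^[j] g) q + c * partialX^[i] (partialY^[j] w) q) V := by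
    intro i
    induction i with
    | zero => exact eqOn_refl _ _
    | succ i ih =>
      simp only [Function.iterate_succ_apply']
      exact (ih.partialX hV).trans fun q hq => partialX_add_mul
        ((iterate_partialX_infty hV (iterate_partialY_infty hV hg j) i).differentiableAt_of_infty
          hV hq) c
        ((iterate_partialX_infty hV (iterate_partialY_infty hV hw j) i).differentiableAt_of_infty
          hV hq)
  exact (((hY j).iterate_partialX hV i).trans (hX i)) hp

end Flat

/-! ### Monomials and homogeneous polynomials -/

/-- The monomial `(x - p.1) ^ m * (y - p.2) ^ n / (m! n!)`. -/
noncomputable def monomialAt (p : ℝ × ℝ) (m n : ℕ) (q : ℝ × ℝ) : ℝ :=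
  (q.1 - p.1) ^ m / (m.factorial : ℝ) * ((q.2 - p.2) ^ n / (n.factorial : ℝ))

theorem contDiff_monomialAt (p : ℝ × ℝ) (m n : ℕ) : ContDiff ℝ ∞ (monomialAt p m n) := by
  unfold monomialAt
  fun_prop

theorem hasDerivAt_sub_pow_div_factorial (c s : ℝ) (m : ℕ) :
    HasDerivAt (fun s : ℝ => (s - c) ^ (m + 1) / ((m + 1).factorial : ℝ))
      ((s - c) ^ m / (m.factorial : ℝ)) s := by
  have h := (((hasDerivAt_id s).sub_const c).pow (m + 1)).div_const ((m + 1).factorial : ℝ)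
  refine h.congr_deriv ?_
  rw [Nat.factorial_succ]
  push_cast
  simp only [id]
  field_simp

theorem partialX_monomialAt_succ (p : ℝ × ℝ) (m n : ℕ) :
    partialX (monomialAt p (m + 1) n) = monomialAt p m n := by
  funext q
  exact ((hasDerivAt_sub_pow_div_factorial p.1 q.1 m).mul_const
    ((q.2 - p.2) ^ n / (n.factorial : ℝ))).deriv

theorem partialY_monomialAt_succ (p : ℝ × ℝ) (m n : ℕ) :
    partialY (monomialAt p m (n + 1)) = monomialAt p m n := by
  funext q
  exact ((hasDerivAt_sub_pow_div_factorial p.2 q.2 n).const_mul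
    ((q.1 - p.1) ^ m / (m.factorial : ℝ))).deriv

theorem partialX_monomialAt_zero (p : ℝ × ℝ) (n : ℕ) :
    partialX (monomialAt p 0 n) = fun _ => 0 := by
  funext q
  simp [partialX, monomialAt]

theorem partialY_monomialAt_zero (p : ℝ × ℝ) (m : ℕ) :
    partialY (monomialAt p m 0) = fun _ => 0 := by
  funext q
  simp [partialY, monomialAt]

theorem flatAt_monomialAt (p : ℝ × ℝ) {m n k : ℕ} (h : k ≤ m + n) :
    FlatAt p k (monomialAt p m n) := by
  induction k generalizing m n with
  | zero => trivial
  | succ k ih =>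
    refine ⟨?_, ?_, ?_⟩
    · rcases m with _ | m
      · have hn : n ≠ 0 := by omega
        simp [monomialAt, hn]
      · simp [monomialAt]
    · rcases m with _ | m
      · rw [partialX_monomialAt_zero]; exact flatAt_zero p k
      · rw [partialX_monomialAt_succ]; exact ih (by omega)
    · rcases n with _ | n
      · rw [partialY_monomialAt_zero]; exact flatAt_zero p k
      · rw [partialY_monomialAt_succ]; exact ih (by omega)

theorem iterate_partialX_zero (i : ℕ) : partialX^[i] (fun _ => 0) = fun _ => 0 := by
  induction i with
  | zero => rfl
  | succ i ih =>
    rw [Function.iterate_succ_apply', ih]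
    funext; simp [partialX]

theorem iterate_partialY_zero (j : ℕ) : partialY^[j] (fun _ => 0) = fun _ => 0 := by
  induction j with
  | zero => rfl
  | succ j ih =>
    rw [Function.iterate_succ_apply', ih]
    funext; simp [partialY]

theorem iterate_partialX_monomialAt (p : ℝ × ℝ) (i m n : ℕ) :
    partialX^[i] (monomialAt p m n) = if i ≤ m then monomialAt p (m - i) n else fun _ => 0 := by
  induction i generalizing m with
  | zero => simp
  | succ i ih =>
    rw [Function.iterate_succ_apply]
    rcases m with _ | m
    · rw [partialX_monomialAt_zero, iterate_partialX_zero]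
      simp
    · rw [partialX_monomialAt_succ, ih]
      simp only [Nat.add_le_add_iff_right, Nat.add_sub_add_right]

theorem iterate_partialY_monomialAt (p : ℝ × ℝ) (j m n : ℕ) :
    partialY^[j] (monomialAt p m n) = if j ≤ n then monomialAt p m (n - j) else fun _ => 0 := by
  induction j generalizing n with
  | zero => simp
  | succ j ih =>
    rw [Function.iterate_succ_apply]
    rcases n with _ | n
    · rw [partialY_monomialAt_zero, iterate_partialY_zero]
      simp
    · rw [partialY_monomialAt_succ, ih]
      simp only [Nat.add_le_add_iff_right, Nat.add_sub_add_right]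

theorem jet_monomialAt (p : ℝ × ℝ) {m n i j : ℕ} (h : i + j = m + n) :
    jet (monomialAt p m n) p i j = if i = m then 1 else 0 := by
  rw [jet, iterate_partialY_monomialAt]
  split_ifs with hj hi hi
  · have : j = n := by omega
    rw [iterate_partialX_monomialAt, if_pos hi.le]
    simp [monomialAt, hi, this]
  · rw [iterate_partialX_monomialAt, if_neg (by omega)]
  · omega
  · rw [iterate_partialX_zero]

/-- The Laplacian. -/
noncomputable def laplacianXY (w : ℝ × ℝ → ℝ) (q : ℝ × ℝ) : ℝ := partialX (partialX w) q + partialY (partialY w) q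

theorem laplacianXY_add_mul {v w : ℝ × ℝ → ℝ} (hv : ContDiff ℝ ∞ v) (c : ℝ)
    (hw : ContDiff ℝ ∞ w) (q : ℝ × ℝ) :
    laplacianXY (fun q => v q + c * w q) q = laplacianXY v q + c * laplacianXY w q := by
  have hd : ∀ {g : ℝ × ℝ → ℝ}, ContDiff ℝ ∞ g → Differentiable ℝ g := fun hg =>
    hg.differentiable (by simp)
  have hX : partialX (fun q => v q + c * w q) = fun q => partialX v q + c * partialX w q :=
    funext fun q => partialX_add_mul (hd hv q) c (hd hw q)
  have hY : partialY (fun q => v q + c * w q) = fun q => partialY v q + c * partialY w q :=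
    funext fun q => partialY_add_mul (hd hv q) c (hd hw q)
  rw [laplacianXY, hX, hY, partialX_add_mul (hd hv.partialX_infty q) c (hd hw.partialX_infty q),
    partialY_add_mul (hd hv.partialY_infty q) c (hd hw.partialY_infty q), laplacianXY, laplacianXY]
  ring

/-- Smooth functions which on the stencils around `p` are homogeneous of degree `d`. -/
structure IsHomogeneousAt (p : ℝ × ℝ) (d : ℕ) (Q : ℝ × ℝ → ℝ) : Prop where
  smooth : ContDiff ℝ ∞ Q
  flat : FlatAt p d Q
  scale : ∀ (h : ℝ) (k l : ℤ), Q (node p h k l) = h ^ d * Q (node p 1 k l)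

theorem isHomogeneousAt_monomialAt (p : ℝ × ℝ) (m n : ℕ) :
    IsHomogeneousAt p (m + n) (monomialAt p m n) where
  smooth := contDiff_monomialAt p m n
  flat := flatAt_monomialAt p le_rfl
  scale h k l := by
    simp only [monomialAt, node]
    ring

theorem IsHomogeneousAt.add_mul {p : ℝ × ℝ} {d : ℕ} {Q Q' : ℝ × ℝ → ℝ}
    (h : IsHomogeneousAt p d Q) (c : ℝ) (h' : IsHomogeneousAt p d Q') :
    IsHomogeneousAt p d (fun q => Q q + c * Q' q) where
  smooth := h.smooth.add (contDiff_const.mul h'.smooth)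
  flat := h.flat.add_mul isOpen_univ (mem_univ p) h.smooth.contDiffOn h'.smooth.contDiffOn c h'.flat
  scale t k l := by rw [h.scale, h'.scale]; ring

theorem laplacianXY_monomialAt_add_two (p : ℝ × ℝ) (m n : ℕ) (q : ℝ × ℝ) :
    laplacianXY (monomialAt p (m + 2) (n + 2)) q
      = monomialAt p m (n + 2) q + monomialAt p (m + 2) n q := by
  simp only [laplacianXY, partialX_monomialAt_succ, partialY_monomialAt_succ]

/-- Integrating twice in `x` solves the problem up to a monomial with two powers of `y` moved to
`x`; the recursion removes it and stops once the power of `y` is zero or one. -/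
theorem exists_laplacianXY_eq_monomialAt (p : ℝ × ℝ) : ∀ n m : ℕ, ∃ Q : ℝ × ℝ → ℝ,
    IsHomogeneousAt p (m + n + 2) Q ∧ ∀ q, laplacianXY Q q = monomialAt p m n q
  | 0, m => ⟨monomialAt p (m + 2) 0, by
      simpa only [add_zero] using isHomogeneousAt_monomialAt p (m + 2) 0, fun q => by
      rw [laplacianXY, partialX_monomialAt_succ, partialX_monomialAt_succ,
        partialY_monomialAt_zero]
      simp [partialY]⟩
  | 1, m => ⟨monomialAt p (m + 2) 1, by
      have := isHomogeneousAt_monomialAt p (m + 2) 1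
      rwa [add_right_comm] at this, fun q => by
      rw [laplacianXY, partialX_monomialAt_succ, partialX_monomialAt_succ,
        partialY_monomialAt_succ, partialY_monomialAt_zero, add_zero]⟩
  | n + 2, m => by
    obtain ⟨Q, hQ, hQl⟩ := exists_laplacianXY_eq_monomialAt p n (m + 2)
    have hm := isHomogeneousAt_monomialAt p (m + 2) (n + 2)
    rw [show m + 2 + (n + 2) = m + (n + 2) + 2 by ring] at hm
    rw [show m + 2 + n + 2 = m + (n + 2) + 2 by ring] at hQ
    refine ⟨_, hm.add_mul (-1) hQ, fun q => ?_⟩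
    rw [laplacianXY_add_mul hm.smooth (-1) hQ.smooth, hQl, laplacianXY_monomialAt_add_two]
    ring

/-! ### Approximate solutions with prescribed leading part -/

/-- The operator `∇ · (a ∇u)`. -/
noncomputable def divGrad (a u : ℝ × ℝ → ℝ) (q : ℝ × ℝ) : ℝ :=
  partialX (fun q => a q * partialX u q) q + partialY (fun q => a q * partialY u q) q

section DivGrad

variable {V : Set (ℝ × ℝ)} {a u w : ℝ × ℝ → ℝ} {p : ℝ × ℝ}

theorem divGrad_eq (hV : IsOpen V) (ha : ContDiffOn ℝ ∞ a V) (hu : ContDiff ℝ ∞ u) {q : ℝ × ℝ}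
    (hq : q ∈ V) : divGrad a u q = a q * laplacianXY u q
      + (partialX a q * partialX u q + partialY a q * partialY u q) := by
  have hd := ha.differentiableAt_of_infty hV hq
  rw [divGrad, partialX_mul hd (hu.partialX_infty.differentiable (by simp) q),
    partialY_mul hd (hu.partialY_infty.differentiable (by simp) q), laplacianXY]
  ring

theorem contDiffOn_divGrad (hV : IsOpen V) (ha : ContDiffOn ℝ ∞ a V) (hu : ContDiff ℝ ∞ u) :
    ContDiffOn ℝ ∞ (divGrad a u) V :=
  ((ha.mul hu.partialX_infty.contDiffOn).partialX_infty hV).add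
    ((ha.mul hu.partialY_infty.contDiffOn).partialY_infty hV)

theorem divGrad_add_mul (hV : IsOpen V) (ha : ContDiffOn ℝ ∞ a V) (hu : ContDiff ℝ ∞ u) (c : ℝ)
    (hw : ContDiff ℝ ∞ w) :
    EqOn (divGrad a (fun q => u q + c * w q)) (fun q => divGrad a u q + c * divGrad a w q) V := by
  intro q hq
  have h1 := divGrad_eq hV ha (hu.add (contDiff_const.mul hw) :
    ContDiff ℝ ∞ fun q => u q + c * w q) hq
  have h2 := divGrad_eq hV ha hu hq
  have h3 := divGrad_eq hV ha hw hq
  rw [laplacianXY_add_mul hu c hw, partialX_add_mul (hu.differentiable (by simp) q) c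
    (hw.differentiable (by simp) q), partialY_add_mul (hu.differentiable (by simp) q) c
    (hw.differentiable (by simp) q)] at h1
  simp only
  rw [h1, h2, h3]
  ring

theorem flatAt_gradient_terms (hV : IsOpen V) (hp : p ∈ V) (ha : ContDiffOn ℝ ∞ a V) {d : ℕ}
    (hu : ContDiff ℝ ∞ u) (h : FlatAt p (d + 1) u) :
    FlatAt p d (fun q => partialX a q * partialX u q + partialY a q * partialY u q) := by
  have haX := ha.partialX_infty hV
  have haY := ha.partialY_infty hV
  have huX := hu.partialX_infty.contDiffOn (s := V)
  have huY := hu.partialY_infty.contDiffOn (s := V)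
  exact FlatAt.add hV hp (haX.mul huX) (haY.mul huY) (h.2.1.mul_left hV hp huX haX)
    (h.2.2.mul_left hV hp huY haY)

/-- Perturbations of a homogeneous leading part of degree `j` that change neither the gradient at `p`
nor the leading behaviour on small stencils. -/
structure IsCorrection (p : ℝ × ℝ) (j : ℕ) (W : ℝ × ℝ → ℝ) : Prop where
  smooth : ContDiff ℝ ∞ W
  gradX : partialX W p = 0
  gradY : partialY W p = 0
  small : ∀ k l : ℤ, Tendsto (fun h : ℝ => W (node p h k l) / h ^ j) (𝓝[>] 0) (𝓝 0)

theorem isCorrection_zero (p : ℝ × ℝ) (j : ℕ) : IsCorrection p j (fun _ => 0) where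
  smooth := contDiff_const
  gradX := by simp [partialX]
  gradY := by simp [partialY]
  small k l := by simp

theorem IsCorrection.add_mul {j d : ℕ} {W Q : ℝ × ℝ → ℝ} (h : IsCorrection p j W) (c : ℝ)
    (hQ : IsHomogeneousAt p (d + 2) Q) (hd : j < d + 2) :
    IsCorrection p j (fun q => W q + c * Q q) where
  smooth := h.smooth.add (contDiff_const.mul hQ.smooth)
  gradX := by
    rw [partialX_add_mul (h.smooth.differentiable (by simp) p) c
      (hQ.smooth.differentiable (by simp) p), h.gradX, hQ.flat.2.1.1]
    simp
  gradY := by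
    rw [partialY_add_mul (h.smooth.differentiable (by simp) p) c
      (hQ.smooth.differentiable (by simp) p), h.gradY, hQ.flat.2.2.1]
    simp
  small k l := by
    have h1 : Tendsto (fun h : ℝ => c * (h ^ (d + 2 - j) * Q (node p 1 k l))) (𝓝[>] 0) (𝓝 0) := by
      have : Continuous fun h : ℝ => c * (h ^ (d + 2 - j) * Q (node p 1 k l)) := by fun_prop
      have h0 := (this.tendsto 0).mono_left (nhdsWithin_le_nhds (s := Ioi 0))
      have hne : d + 2 - j ≠ 0 := by omega
      simpa [hne] using h0
    have h2 := (h.small k l).add h1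
    rw [add_zero] at h2
    refine h2.congr' ?_
    filter_upwards [self_mem_nhdsWithin] with t ht
    have ht0 : t ≠ 0 := (show 0 < t from ht).ne'
    have : t ^ (d + 2) = t ^ (d + 2 - j) * t ^ j := by rw [← pow_add]; congr 1; omega
    rw [hQ.scale t, this]
    field_simp

/-- Since `P` is harmonic, its residual has only first order terms and is flat of order `j`. The
flatness is raised by one at a time, with the top part of the operator at `p`, which is `a p` times
the Laplacian, inverted on monomials. -/
theorem exists_correction (hV : IsOpen V) (hp : p ∈ V) (ha : ContDiffOn ℝ ∞ a V) (ha0 : a p ≠ 0)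
    {j : ℕ} {P : ℝ × ℝ → ℝ} (hP : IsHomogeneousAt p (j + 1) P) (hPl : ∀ q, laplacianXY P q = 0)
    (N : ℕ) (hN : j ≤ N) : ∃ W, IsCorrection p (j + 1) W ∧
      FlatAt p N (divGrad a (fun q => P q + W q)) := by
  induction N, hN using Nat.le_induction with
  | base =>
    refine ⟨_, isCorrection_zero p (j + 1), ?_⟩
    simp only [add_zero]
    refine (flatAt_gradient_terms hV hp ha hP.smooth hP.flat).congr hV hp fun q hq => ?_
    have := divGrad_eq hV ha hP.smooth hq
    rw [hPl, mul_zero, zero_add] at this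
    exact this.symm
  | succ N hN ih =>
    -- The derivatives of order `N` of the residual are removed one by one; those with `x`-index
    -- below `k` are already gone.
    have step : ∀ k ≤ N + 1, ∃ W, IsCorrection p (j + 1) W ∧
        FlatAt p N (divGrad a (fun q => P q + W q)) ∧
        ∀ i < k, jet (divGrad a (fun q => P q + W q)) p i (N - i) = 0 := by
      intro k
      induction k with
      | zero =>
        obtain ⟨W, hW, hWN⟩ := ih
        exact fun _ => ⟨W, hW, hWN, fun i hi => absurd hi (Nat.not_lt_zero i)⟩
      | succ k ihk =>
        intro hk
        obtain ⟨W, hW, hWN, hWk⟩ := ihk (by omega)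
        obtain ⟨Q, hQ, hQl⟩ := exists_laplacianXY_eq_monomialAt p (N - k) k
        rw [show k + (N - k) = N by omega] at hQ
        set G := divGrad a (fun q => P q + W q)
        set c := -jet G p k (N - k) / a p with hc
        have hPW : ContDiff ℝ ∞ (fun q => P q + W q) := hP.smooth.add hW.smooth
        have hG : ContDiffOn ℝ ∞ G V := contDiffOn_divGrad hV ha hPW
        have hLQ : ContDiffOn ℝ ∞ (divGrad a Q) V := contDiffOn_divGrad hV ha hQ.smooth
        have hmono : ContDiffOn ℝ ∞ (monomialAt p k (N - k)) V :=
          (contDiff_monomialAt p k (N - k)).contDiffOn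
        have hmflat : FlatAt p N (monomialAt p k (N - k)) := flatAt_monomialAt p (by omega)
        -- With `ΔQ` equal to the monomial, the difference is `(a - a p)` times the monomial plus
        -- first order terms in `Q`, and both are flat of order `N + 1`. Hence, in order `N`, adding
        -- `c * Q` changes the derivative of index `k` alone.
        have hrem : FlatAt p (N + 1)
            (fun q => divGrad a Q q + -a p * monomialAt p k (N - k) q) := by
          have haX := ha.partialX_infty hV
          have haY := ha.partialY_infty hV
          have hQX := hQ.smooth.partialX_infty.contDiffOn (s := V)
          have hQY := hQ.smooth.partialY_infty.contDiffOn (s := V)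
          have hsub : ContDiffOn ℝ ∞ (fun q => a q - a p) V := ha.sub contDiffOn_const
          refine FlatAt.congr hV hp (FlatAt.add hV hp (hsub.mul hmono)
            ((haX.mul hQX).add (haY.mul hQY))
            (hmflat.mul_left_of_eq_zero hV hp hmono hsub (sub_self _))
            (flatAt_gradient_terms hV hp ha hQ.smooth hQ.flat)) fun q hq => ?_
          have := divGrad_eq hV ha hQ.smooth hq
          rw [hQl] at this
          rw [this]
          ring
        have hjQ : ∀ i ≤ N, jet (divGrad a Q) p i (N - i) = if i = k then a p else 0 := by
          intro i hi
          have h1 := hrem.jet_eq_zero (show i + (N - i) < N + 1 by omega)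
          rw [jet_add_mul hV hp hLQ hmono, jet_monomialAt p (by omega)] at h1
          split_ifs at h1 ⊢ <;> linarith
        have hLQN : FlatAt p N (divGrad a Q) := by
          refine FlatAt.congr hV hp (FlatAt.add_mul hV hp
            (hLQ.add (contDiffOn_const.mul hmono)) hmono (hrem.mono (Nat.le_succ N)) (a p) hmflat)
            fun q _ => ?_
          ring
        have hEq : EqOn (fun q => G q + c * divGrad a Q q)
            (divGrad a (fun q => P q + (W q + c * Q q))) V := by
          intro q hq
          have := divGrad_add_mul hV ha hPW c hQ.smooth hq
          simp only [add_assoc] at this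
          exact this.symm
        refine ⟨_, hW.add_mul c hQ (by omega),
          (hWN.add_mul hV hp hG hLQ c hLQN).congr hV hp hEq, fun i hi => ?_⟩
        rw [← hEq.jet hV hp, jet_add_mul hV hp hG hLQ, hjQ i (by omega)]
        split_ifs with hik
        · rw [hik, hc]
          field_simp
          ring
        · rw [hWk i (by omega)]
          ring
    obtain ⟨W, hW, hWN, hWk⟩ := step (N + 1) le_rfl
    refine ⟨W, hW, FlatAt.of_jet hV hp (contDiffOn_divGrad hV ha (hP.smooth.add hW.smooth))
      fun i l hil => ?_⟩
    rcases Nat.lt_succ_iff_lt_or_eq.1 hil with h | h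
    · exact hWN.jet_eq_zero h
    · have := hWk i (by omega)
      rwa [← h, Nat.add_sub_cancel_left] at this

end DivGrad

/-! ### Four is the maximal order -/

/-- On a corrected solution all source terms of the scheme vanish, the gradient at `p` is that of
`P`, and after division by `h ^ (j + 1)` the nodal values tend to those of `P` on the unit stencil.
-/
theorem IsCompactGradientScheme.tendsto {V : Set (ℝ × ℝ)} (hV : IsOpen V) {a : ℝ × ℝ → ℝ}
    (ha : ContDiffOn ℝ ∞ a V) {p : ℝ × ℝ} (hp : p ∈ V) (ha0 : a p ≠ 0) {θ : ℝ} {M : ℕ}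
    {C : ℤ → ℤ → Polynomial ℝ} {Cf : ℕ → ℕ → Polynomial ℝ}
    (hC : IsCompactGradientScheme a V p θ M C Cf) {j : ℕ} (hj : j ≤ M) {P : ℝ × ℝ → ℝ}
    (hP : IsHomogeneousAt p (j + 1) P) (hPl : ∀ q, laplacianXY P q = 0) :
    Tendsto (fun h : ℝ => h * (Real.cos θ * partialX P p + Real.sin θ * partialY P p) / h ^ (j + 1))
      (𝓝[>] 0) (𝓝 (∑ k ∈ stencil, ∑ l ∈ stencil, (C k l).eval 0 * P (node p 1 k l))) := by
  obtain ⟨W, hW, hWM⟩ := exists_correction hV hp ha ha0 hP hPl M hj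
  have hu : ContDiff ℝ ∞ (fun q => P q + W q) := hP.smooth.add hW.smooth
  have hbig := hC (fun q => P q + W q) (fun q => -divGrad a (fun q => P q + W q) q) hu
    (fun q _ => rfl)
  have hflat : FlatAt p M (fun q => -divGrad a (fun q => P q + W q) q) := by
    have := hWM.mul_left hV hp (contDiffOn_divGrad hV ha hu) (w := fun _ => -1) contDiffOn_const
    simpa using this
  have hsrc : ∀ h : ℝ, ∑ q ∈ (Lam M).filter (fun q => q.1 + q.2 < M),
      jet (fun q => -divGrad a (fun q => P q + W q) q) p q.1 q.2 * (Cf q.1 q.2).eval h = 0 :=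
    fun h => Finset.sum_eq_zero fun q hq => by
      rw [hflat.jet_eq_zero (Finset.mem_filter.1 hq).2, zero_mul]
  have hPd := hP.smooth.differentiable (by simp) p
  have hWd := hW.smooth.differentiable (by simp) p
  simp only [hsrc, sub_zero, partialX_add hPd hWd, partialY_add hPd hWd, hW.gradX, hW.gradY,
    add_zero] at hbig
  -- The error `O(h ^ (M + 2))` is negligible against `h ^ (j + 1)` because `j ≤ M`.
  have hlittle := hbig.trans_isLittleO
    ((isLittleO_pow_pow (𝕜 := ℝ) (show j + 1 < M + 2 by omega)).mono
      (nhdsWithin_le_nhds (s := Ioi (0 : ℝ))))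
  have h1 := hlittle.tendsto_div_nhds_zero
  have h2 : Tendsto (fun h : ℝ => ∑ k ∈ stencil, ∑ l ∈ stencil,
      (C k l).eval h * (P (node p 1 k l) + W (node p h k l) / h ^ (j + 1))) (𝓝[>] 0)
      (𝓝 (∑ k ∈ stencil, ∑ l ∈ stencil, (C k l).eval 0 * P (node p 1 k l))) := by
    refine tendsto_finsetSum _ fun k _ => tendsto_finsetSum _ fun l _ => ?_
    refine (((C k l).continuous.tendsto 0).mono_left nhdsWithin_le_nhds).mul ?_
    simpa using tendsto_const_nhds.add (hW.small k l)
  have h3 := h1.add h2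
  rw [zero_add] at h3
  refine h3.congr' ?_
  filter_upwards [self_mem_nhdsWithin] with h hh
  have hh0 : h ≠ 0 := (show 0 < h from hh).ne'
  have h4 : ∑ k ∈ stencil, ∑ l ∈ stencil,
      (C k l).eval h * (P (node p 1 k l) + W (node p h k l) / h ^ (j + 1))
      = (∑ k ∈ stencil, ∑ l ∈ stencil, (C k l).eval h * (P (node p h k l) + W (node p h k l)))
        / h ^ (j + 1) := by
    simp only [Finset.sum_div]
    refine Finset.sum_congr rfl fun k _ => Finset.sum_congr rfl fun l _ => ?_
    rw [hP.scale h]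
    field_simp
  rw [h4, ← add_div, sub_add_cancel]

theorem IsCompactGradientScheme.sum_eq_zero {V : Set (ℝ × ℝ)} (hV : IsOpen V) {a : ℝ × ℝ → ℝ}
    (ha : ContDiffOn ℝ ∞ a V) {p : ℝ × ℝ} (hp : p ∈ V) (ha0 : a p ≠ 0) {θ : ℝ} {M : ℕ}
    {C : ℤ → ℤ → Polynomial ℝ} {Cf : ℕ → ℕ → Polynomial ℝ}
    (hC : IsCompactGradientScheme a V p θ M C Cf) {j : ℕ} (hj : j + 1 ≤ M) {P : ℝ × ℝ → ℝ}
    (hP : IsHomogeneousAt p (j + 2) P) (hPl : ∀ q, laplacianXY P q = 0) :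
    ∑ k ∈ stencil, ∑ l ∈ stencil, (C k l).eval 0 * P (node p 1 k l) = 0 := by
  have h := hC.tendsto hV ha hp ha0 hj hP hPl
  simp only [hP.flat.2.1.1, hP.flat.2.2.1, mul_zero, add_zero, zero_div] at h
  exact tendsto_nhds_unique h tendsto_const_nhds

theorem IsCompactGradientScheme.sum_eq_deriv {V : Set (ℝ × ℝ)} (hV : IsOpen V) {a : ℝ × ℝ → ℝ}
    (ha : ContDiffOn ℝ ∞ a V) {p : ℝ × ℝ} (hp : p ∈ V) (ha0 : a p ≠ 0) {θ : ℝ} {M : ℕ}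
    {C : ℤ → ℤ → Polynomial ℝ} {Cf : ℕ → ℕ → Polynomial ℝ}
    (hC : IsCompactGradientScheme a V p θ M C Cf) {P : ℝ × ℝ → ℝ}
    (hP : IsHomogeneousAt p 1 P) (hPl : ∀ q, laplacianXY P q = 0) :
    ∑ k ∈ stencil, ∑ l ∈ stencil, (C k l).eval 0 * P (node p 1 k l)
      = Real.cos θ * partialX P p + Real.sin θ * partialY P p := by
  have h := hC.tendsto hV ha hp ha0 (Nat.zero_le M) hP hPl
  refine tendsto_nhds_unique h (tendsto_const_nhds.congr' ?_)
  filter_upwards [self_mem_nhdsWithin] with t ht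
  have ht0 : t ≠ 0 := (show 0 < t from ht).ne'
  rw [zero_add, pow_one]
  field_simp

/-- The tests are multiples of the real and imaginary parts of `z`, `z ^ 3`, `z ^ 5`. On the unit
stencil those odd in `x` see the weights only through `s = ∑ k * C k 0` and `d`, the sum of `k * C k
l` over the corners, with the values at `h = 0`. The conditions read `s + d = cos θ`, `s - 2 * d =
0`, `s - 4 * d = 0`, whence `cos θ = 0`; symmetrically `sin θ = 0`. The third condition, of degree
five, is available exactly from `M = 4` on. -/
theorem IsCompactGradientScheme.le_three {V : Set (ℝ × ℝ)} (hV : IsOpen V) {a : ℝ × ℝ → ℝ}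
    (ha : ContDiffOn ℝ ∞ a V) {p : ℝ × ℝ} (hp : p ∈ V) (ha0 : a p ≠ 0) {θ : ℝ} {M : ℕ}
    {C : ℤ → ℤ → Polynomial ℝ} {Cf : ℕ → ℕ → Polynomial ℝ}
    (hC : IsCompactGradientScheme a V p θ M C Cf) : M ≤ 3 := by
  by_contra! hM
  have hm := isHomogeneousAt_monomialAt p
  have hs := contDiff_monomialAt p
  have hX0 : ∀ n q, partialX (partialX (monomialAt p 1 n)) q = 0 := fun n q => by
    rw [partialX_monomialAt_succ, partialX_monomialAt_zero]
  have hY0 : ∀ m q, partialY (partialY (monomialAt p m 1)) q = 0 := fun m q => by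
    rw [partialY_monomialAt_succ, partialY_monomialAt_zero]
  have hX00 : ∀ n q, partialX (partialX (monomialAt p 0 n)) q = 0 := fun n q => by
    rw [partialX_monomialAt_zero]; simp [partialX]
  have hY00 : ∀ m q, partialY (partialY (monomialAt p m 0)) q = 0 := fun m q => by
    rw [partialY_monomialAt_zero]; simp [partialY]
  have hXX : ∀ m n q, partialX (partialX (monomialAt p (m + 2) n)) q = monomialAt p m n q :=
    fun m n q => by rw [partialX_monomialAt_succ, partialX_monomialAt_succ]
  have hYY : ∀ m n q, partialY (partialY (monomialAt p m (n + 2))) q = monomialAt p m n q :=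
    fun m n q => by rw [partialY_monomialAt_succ, partialY_monomialAt_succ]
  have x1 := hC.sum_eq_deriv hV ha hp ha0 (hm 1 0) fun q => by
    simp only [laplacianXY, hX0, hY00, add_zero]
  have y1 := hC.sum_eq_deriv hV ha hp ha0 (hm 0 1) fun q => by
    simp only [laplacianXY, hX00, hY0, add_zero]
  have x3 := hC.sum_eq_zero hV ha hp ha0 (j := 1) (by omega) ((hm 3 0).add_mul (-1) (hm 1 2))
    fun q => by
      rw [laplacianXY_add_mul (hs _ _) _ (hs _ _)]
      simp only [laplacianXY, hX0, hY00, hXX 1, hYY _ 0]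
      ring
  have y3 := hC.sum_eq_zero hV ha hp ha0 (j := 1) (by omega) ((hm 0 3).add_mul (-1) (hm 2 1))
    fun q => by
      rw [laplacianXY_add_mul (hs _ _) _ (hs _ _)]
      simp only [laplacianXY, hX00, hY0, hXX 0, hYY _ 1]
      ring
  have x5 := hC.sum_eq_zero hV ha hp ha0 (j := 3) (by omega)
    (((hm 5 0).add_mul (-1) (hm 3 2)).add_mul 1 (hm 1 4)) fun q => by
      rw [laplacianXY_add_mul ((hm 5 0).add_mul (-1) (hm 3 2)).smooth _ (hs _ _),
        laplacianXY_add_mul (hs _ _) _ (hs _ _)]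
      simp only [laplacianXY, hX0, hY00, hXX 3, hXX 1, hYY _ 0, hYY _ 2]
      ring
  have y5 := hC.sum_eq_zero hV ha hp ha0 (j := 3) (by omega)
    (((hm 0 5).add_mul (-1) (hm 2 3)).add_mul 1 (hm 4 1)) fun q => by
      rw [laplacianXY_add_mul ((hm 0 5).add_mul (-1) (hm 2 3)).smooth _ (hs _ _),
        laplacianXY_add_mul (hs _ _) _ (hs _ _)]
      simp only [laplacianXY, hX00, hY0, hXX 0, hXX 2, hYY _ 3, hYY _ 1]
      ring
  rw [partialX_monomialAt_succ, partialY_monomialAt_zero] at x1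
  rw [partialX_monomialAt_zero, partialY_monomialAt_succ] at y1
  simp only [sum_stencil, monomialAt, node, Nat.factorial] at x1 y1 x3 y3 x5 y5
  norm_num at x1 y1 x3 y3 x5 y5
  have hcos : Real.cos θ = 0 := by linarith
  have hsin : Real.sin θ = 0 := by linarith
  have := Real.sin_sq_add_cos_sq θ
  rw [hcos, hsin] at this
  norm_num at this

/-! ### Consistency, uniformity and maximality combined -/

theorem mainTheorem5 (l₁ l₂ l₃ l₄ : ℝ) (ψ a f u : ℝ × ℝ → ℝ)
    (hψ : ContDiff ℝ ∞ ψ)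
    (ha : ContDiffOn ℝ ∞ a (offInterface (rect l₁ l₂ l₃ l₄) ψ))
    (hapos : ∀ p ∈ offInterface (rect l₁ l₂ l₃ l₄) ψ, 0 < a p)
    (hf : ContDiffOn ℝ ∞ f (offInterface (rect l₁ l₂ l₃ l₄) ψ))
    (hu : ContDiffOn ℝ 5 u (offInterface (rect l₁ l₂ l₃ l₄) ψ))
    (hpde : SolvesOn a u f (offInterface (rect l₁ l₂ l₃ l₄) ψ)) :
    -- fourth order at the points off the interface, locally uniformly
    (∀ S : Set (ℝ × ℝ), IsCompact S → S ⊆ offInterface (rect l₁ l₂ l₃ l₄) ψ →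
      ∃ K > 0, ∃ h₀ > 0, ∀ p ∈ S, ∀ h : ℝ, 0 < h → h ≤ h₀ →
        IsRegularPoint ψ p h ∧
        |gradX (jet a p) (jet f p) (fun k l => u (node p h k l)) h - partialX u p| ≤ K * h ^ 4 ∧
        |gradY (jet a p) (jet f p) (fun k l => u (node p h k l)) h - partialY u p| ≤ K * h ^ 4) ∧
    -- fourth order uniformly over all meshes and all their regular points, when the
    -- data on a side extend smoothly up to (and across) the interface and the boundary
    ((∀ q ∈ rect l₁ l₂ l₃ l₄, ψ q = 0 → fderiv ℝ ψ q ≠ 0) →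
      ∀ (s : Side) (A F U : ℝ × ℝ → ℝ),
        ContDiff ℝ ∞ A → ContDiff ℝ ∞ F → ContDiff ℝ 5 U →
        EqOn A a (s.region (rect l₁ l₂ l₃ l₄) ψ) →
        EqOn F f (s.region (rect l₁ l₂ l₃ l₄) ψ) →
        EqOn U u (s.region (rect l₁ l₂ l₃ l₄) ψ) →
        (∀ q ∈ closure (s.region (rect l₁ l₂ l₃ l₄) ψ), 0 < A q) →
        ∃ K > 0, ∀ p : ℝ × ℝ, ∀ h : ℝ, 0 < h →
          (∀ k ∈ stencil, ∀ l ∈ stencil,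
            node p h k l ∈ Icc l₁ l₂ ×ˢ Icc l₃ l₄ ∧ node p h k l ∈ s.points ψ) →
          |gradX (jet A p) (jet F p) (fun k l => U (node p h k l)) h - partialX U p|
              ≤ K * h ^ 4 ∧
          |gradY (jet A p) (jet F p) (fun k l => U (node p h k l)) h - partialY U p|
              ≤ K * h ^ 4) ∧
    -- four is the maximal order of a compact approximation
    (∀ p ∈ offInterface (rect l₁ l₂ l₃ l₄) ψ, ∀ θ : ℝ,
      (∃ (C : ℤ → ℤ → Polynomial ℝ) (Cf : ℕ → ℕ → Polynomial ℝ),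
        (∀ k l, (C k l).natDegree ≤ 4) ∧ (∀ m n, (Cf m n).natDegree ≤ 4) ∧
        IsCompactGradientScheme a (offInterface (rect l₁ l₂ l₃ l₄) ψ) p θ 3 C Cf) ∧
      ∀ (M : ℕ) (C : ℤ → ℤ → Polynomial ℝ) (Cf : ℕ → ℕ → Polynomial ℝ),
        IsCompactGradientScheme a (offInterface (rect l₁ l₂ l₃ l₄) ψ) p θ M C Cf → M ≤ 3) := by
  have hV := isOpen_offInterface (isOpen_rect l₁ l₂ l₃ l₄) hψ.continuous
  have ha0 : ∀ p ∈ offInterface (rect l₁ l₂ l₃ l₄) ψ, a p ≠ 0 := fun p hp => (hapos p hp).ne'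
  refine ⟨fun S hS hSV => ?_, fun hd s A F U hA hF hU hAa hFf hUu hpos => ?_, fun p hp θ =>
    ⟨exists_compactGradientScheme hV ha ha0 hp θ, fun M C Cf hC =>
      hC.le_three hV ha hp (ha0 p hp)⟩⟩
  · obtain ⟨K, hK, δ, hδ, hb⟩ := exists_local_gradient_bound hV hS hSV ha hu ha0 hpde
    refine ⟨K, hK, δ, hδ, fun p hp h hh hhδ => ?_⟩
    obtain ⟨hbox, hX, hY⟩ := hb p hp h hh hhδ
    exact ⟨isRegularPoint_of_box hψ.continuous hh.le fun q hq => (hbox hq).2, hX, hY⟩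
  · exact exists_gradient_bound_side hψ.continuous ha hu hpde hd s hA hF hU hAa hFf hUu hpos
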